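/- Let $F$ be a number field with a fixed algebraic closure $\overline F$, and for $m\ge 1$ let $\zeta_m\in\overline F$ be a primitive $m$-th root of unity. For an elliptic curve $E/F$ and $m\ge1$, let $F(E[m])\subseteq\overline F$ be the extension of $F$ generated by the coordinates of the $m$-torsion points of $E(\overline F)$. Let $E/F$ be an elliptic curve, $p$ a prime and $k\ge 1$ an integer such that $F\cap\mathbb{Q}(\zeta_{p^k})=\mathbb{Q}$; if $k=1$, assume moreover that $F\cap\mathbb{Q}(\zeta_{p^2})=\mathbb{Q}$. (For odd $p$ and every $k\geq 1$ these hypotheses together are equivalent to $F\cap\mathbb{Q}(\zeta_{p^{k+1}})=\mathbb{Q}$.) Then: 1. if $F(\zeta_{p^{k+1}})\subseteq F(E[p^k])$, then $p=2$; 2. if $E/F$ has a $(p^k,p^{k+1})$-coincidence, that is, if $F(E[p^k])=F(E[p^{k+1}])$, then $p=2$. -/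

import Mathlib

open scoped IntermediateField

namespace EllipticDivision

variable (F : Type*) [Field F] (Ω : Type*) [Field Ω] [Algebra F Ω]

open scoped Classical in
/-- The `n`-torsion subgroup `E[n]` of the group `E(Ω)` of `Ω`-points of a Weierstrass curve `E`
over `F`, for a field extension `Ω` of `F`. -/
noncomputable def torsion (E : WeierstrassCurve F) (n : ℕ) :
    AddSubgroup (E.baseChange Ω).toAffine.Point :=
  (nsmulAddMonoidHom (α := (E.baseChange Ω).toAffine.Point) n).ker

/-- The set of affine coordinates of the `n`-torsion points of `E` over `Ω`
(the point at infinity contributes nothing). -/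
def torsionCoordinates (E : WeierstrassCurve F) (n : ℕ) : Set Ω :=
  {z | ∃ (x y : Ω) (h : (E.baseChange Ω).toAffine.Nonsingular x y),
    WeierstrassCurve.Affine.Point.some x y h ∈ torsion F Ω E n ∧ (z = x ∨ z = y)}

/-- The `n`-division field `F(E[n])`, inside an extension `Ω` of `F`
(to be taken algebraically closed). -/
noncomputable def divisionField (E : WeierstrassCurve F) (n : ℕ) : IntermediateField F Ω :=
  IntermediateField.adjoin F (torsionCoordinates F Ω E n)

end EllipticDivision

/-! Let `p` be odd. It suffices to find an automorphism `τ` over `F` that fixes `F(E[p^k])` and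
moves `ζ_{p^{k+1}}`. This refutes the inclusion in 1. It also refutes the coincidence in 2, since
the Weil pairing puts `ζ_{p^{k+1}}` into `F(E[p^{k+1}])`.

To build `τ`, let `g` generate `(ℤ/p²)ˣ`. As `F ∩ ℚ(ζ_{p²}) = ℚ`, some `σ` over `F` raises `ζ_{p²}`
to the power `g`. By equivariance of the Weil pairing, `σ` has determinant `g` on `E[p]`. This is a
non-square, so `tr² - 4 det ≠ 0`, the action is semisimple and `σ^{p²-1}` is trivial on `E[p]`. Each
further `p`-th power gains one level of torsion, so `τ = σ^{(p²-1)p^{k-1}}` is trivial on `E[p^k]`.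
On roots of unity there is no such gain: `g^{p²-1} ≢ 1 mod p²`, and lifting the exponent shows that
`τ` moves `ζ_{p^{k+1}}`. This is `exists_apply_eq_and_apply_ne`.

The Weil pairing is obtained as a theta group commutator. Let `V` be the functions with a pole of
order at most `n` at infinity. For an `n`-torsion point `P`, translation by `P` times a suitable
function acts on `V`. This operator is unique up to a scalar (`IsThetaOperator.exists_eq_smul`), so
operators over `P` and `Q` commute up to a scalar, the pairing of `P` and `Q`. It is bilinear and
alternating, and equivariant because conjugating a theta operator gives a theta operator. If it is
trivial on `P, Q`, the operators have a common eigenvector, whose zeros are essentially stable under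
the group generated by `P` and `Q`; a function in `V` has too few zeros when that group is large
(`thetaPairing_ne_one`).

Enough torsion comes from writing `x(nP) = a(x)/b(x)` with `a, b` coprime and `deg a = n²`: a
generic fibre of multiplication by `n` then has `n²` distinct `x`-coordinates
(`Point.exists_torsion_finset`). -/

/-! ### Theta operators on a space of functions and their commutators -/

section ThetaOperators

open Filter

variable {K A : Type*} [Field K]

/-- Every nonzero function in `V` has finitely many zeros. -/
def HasFinitelyManyZeros (V : Submodule K (A → K)) : Prop :=
  ∀ s : V, s ≠ 0 → ∀ᶠ X in cofinite, (s : A → K) X ≠ 0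

theorem HasFinitelyManyZeros.eq_zero [Infinite A] {V : Submodule K (A → K)}
    (hV : HasFinitelyManyZeros V) {s : V} (hs : ∀ᶠ X in cofinite, (s : A → K) X = 0) : s = 0 := by
  by_contra h
  obtain ⟨X, h1, h2⟩ := (hs.and (hV s h)).exists
  exact h2 h1

variable [AddCommGroup A]

/-- An endomorphism `T` of a space `V` of functions on the group `A` lies over `P : A` if, away from
finitely many points, it is translation by `P` followed by multiplication by a nonvanishing
function. -/
def IsThetaOperator (V : Submodule K (A → K)) (P : A) (T : Module.End K V) : Prop :=
  ∃ h : A → K, ∀ᶠ X in cofinite, h X ≠ 0 ∧ ∀ s : V, (T s : A → K) X = h X * (s : A → K) (X + P)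

variable {V : Submodule K (A → K)} {P Q : A} {S T : Module.End K V}

theorem eventually_cofinite_add_right (Q : A) {p : A → Prop} (h : ∀ᶠ X in cofinite, p X) :
    ∀ᶠ X in cofinite, p (X + Q) :=
  (add_left_injective Q).tendsto_cofinite.eventually h

theorem IsThetaOperator.one : IsThetaOperator V 0 1 :=
  ⟨fun _ => 1, Eventually.of_forall fun X => ⟨one_ne_zero, fun s => by simp⟩⟩

theorem IsThetaOperator.mul (hS : IsThetaOperator V P S) (hT : IsThetaOperator V Q T) :
    IsThetaOperator V (P + Q) (S * T) := by
  obtain ⟨f, hf⟩ := hS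
  obtain ⟨g, hg⟩ := hT
  refine ⟨fun X => f X * g (X + P), ?_⟩
  filter_upwards [hf, eventually_cofinite_add_right P hg] with X h1 h2
  refine ⟨mul_ne_zero h1.1 h2.1, fun s => ?_⟩
  rw [Module.End.mul_apply, h1.2, h2.2, mul_assoc, add_assoc]

theorem IsThetaOperator.injective [Infinite A] (hV : HasFinitelyManyZeros V)
    (hT : IsThetaOperator V P T) : Function.Injective T := by
  rw [injective_iff_map_eq_zero]
  intro s hs
  obtain ⟨g, hg⟩ := hT
  refine hV.eq_zero ?_
  have := eventually_cofinite_add_right (-P) hg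
  filter_upwards [this] with X hX
  have h2 := hX.2 s
  rw [hs, neg_add_cancel_right] at h2
  simpa [hX.1] using h2.symm

/-- An eigenvector of `S T⁻¹` gives `u ≠ 0` with `S u = c T u`. Comparing values where `u(X + P) ≠
0` shows that the multipliers of `S` and `T` have ratio `c` almost everywhere, which forces `S = c
T` on all of `V`. -/
theorem IsThetaOperator.exists_eq_smul [IsAlgClosed K] [Infinite A] [FiniteDimensional K V]
    [Nontrivial V] (hV : HasFinitelyManyZeros V)
    (hS : IsThetaOperator V P S) (hT : IsThetaOperator V P T) : ∃ c : K, c ≠ 0 ∧ S = c • T := by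
  have hTi := hT.injective hV
  let e : V ≃ₗ[K] V := LinearEquiv.ofInjectiveEndo T hTi
  obtain ⟨c, hc⟩ := Module.End.exists_eigenvalue (S * (e.symm : V →ₗ[K] V))
  obtain ⟨v, hv⟩ := hc.exists_hasEigenvector
  obtain ⟨f, hf⟩ := hS
  obtain ⟨g, hg⟩ := hT
  have hu0 : e.symm v ≠ 0 := by simpa using hv.2
  have hSu : S (e.symm v) = c • T (e.symm v) := by
    have h1 := hv.apply_eq_smul
    have h2 : T (e.symm v) = v := e.apply_symm_apply v
    rw [h2]
    exact h1
  have hfg : ∀ᶠ X in cofinite, f X = c * g X := by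
    filter_upwards [hf, hg, eventually_cofinite_add_right P (hV _ hu0)] with X h1 h2 h3
    have h4 := congrArg (fun w : V => (w : A → K) X) hSu
    simp only [Submodule.coe_smul, Pi.smul_apply, smul_eq_mul] at h4
    rw [h1.2, h2.2, ← mul_assoc] at h4
    exact mul_right_cancel₀ h3 h4
  refine ⟨c, ?_, ?_⟩
  · rintro rfl
    obtain ⟨X, h1, h2⟩ := (hf.and hfg).exists
    exact h1.1 (by simpa using h2)
  · ext1 s
    rw [← sub_eq_zero]
    refine hV.eq_zero ?_
    filter_upwards [hf, hg, hfg] with X h1 h2 h3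
    simp [h1.2, h2.2, h3, mul_assoc]

/-- The relation stating that `c` is the commutator of theta operators over `P` and `Q`. -/
def IsThetaCommutator (V : Submodule K (A → K)) (P Q : A) (c : K) : Prop :=
  c ≠ 0 ∧ ∀ S T : Module.End K V, IsThetaOperator V P S → IsThetaOperator V Q T →
    S * T = c • (T * S)

/-- Both `S T` and `T S` lie over `P + Q`, hence are proportional. Rescaling `S` or `T` does not
change the ratio, so it depends only on the two points. -/
theorem exists_isThetaCommutator [IsAlgClosed K] [Infinite A] [FiniteDimensional K V]
    [Nontrivial V] (hV : HasFinitelyManyZeros V)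
    (hS : IsThetaOperator V P S) (hT : IsThetaOperator V Q T) :
    ∃ c, IsThetaCommutator V P Q c := by
  obtain ⟨c, hc, h⟩ := (hS.mul hT).exists_eq_smul hV (add_comm P Q ▸ hT.mul hS)
  refine ⟨c, hc, fun S' T' hS' hT' => ?_⟩
  obtain ⟨a, -, rfl⟩ := hS'.exists_eq_smul hV hS
  obtain ⟨b, -, rfl⟩ := hT'.exists_eq_smul hV hT
  simp only [smul_mul_assoc, mul_smul_comm, h]
  rw [smul_comm b a, smul_comm b c, smul_comm a c]

theorem IsThetaCommutator.eq_of_mul_eq [Infinite A] [Nontrivial V] (hV : HasFinitelyManyZeros V)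
    (hS : IsThetaOperator V P S) (hT : IsThetaOperator V Q T) {c d : K}
    (hc : IsThetaCommutator V P Q c) (hd : S * T = d • (T * S)) : c = d := by
  have h := hc.2 S T hS hT
  rw [hd] at h
  obtain ⟨v, hv⟩ := exists_ne (0 : V)
  have h2 := congrArg (fun R : Module.End K V => R v) h
  simp only [LinearMap.smul_apply] at h2
  have h3 : (T * S) v ≠ 0 := by
    intro h0
    apply hv
    exact (hT.mul hS).injective hV (by rw [h0, map_zero])
  exact (smul_left_injective K h3 h2).symm

theorem IsThetaCommutator.self (hV : HasFinitelyManyZeros V) [Infinite A] [Nontrivial V]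
    (hS : IsThetaOperator V P S) {c : K} (hc : IsThetaCommutator V P P c) : c = 1 :=
  hc.eq_of_mul_eq hV hS hS (by simp)

theorem IsThetaCommutator.symm {c : K} (hc : IsThetaCommutator V P Q c) :
    IsThetaCommutator V Q P c⁻¹ := by
  refine ⟨inv_ne_zero hc.1, fun S T hS hT => ?_⟩
  rw [hc.2 T S hT hS, smul_smul, inv_mul_cancel₀ hc.1, one_smul]

theorem IsThetaCommutator.add_left [IsAlgClosed K] [Infinite A] [FiniteDimensional K V]
    [Nontrivial V] (hV : HasFinitelyManyZeros V) {P' : A} {c c' : K}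
    (hS : IsThetaOperator V P S) {S' : Module.End K V} (hS' : IsThetaOperator V P' S')
    (hc : IsThetaCommutator V P Q c) (hc' : IsThetaCommutator V P' Q c') :
    IsThetaCommutator V (P + P') Q (c * c') := by
  refine ⟨mul_ne_zero hc.1 hc'.1, fun R T hR hT => ?_⟩
  obtain ⟨a, -, rfl⟩ := hR.exists_eq_smul hV (hS.mul hS')
  have h1 := hc.2 S T hS hT
  have h2 := hc'.2 S' T hS' hT
  have h3 : S * S' * T = (c * c') • (T * (S * S')) := by
    rw [mul_assoc, h2, mul_smul_comm, ← mul_assoc, h1, smul_mul_assoc, smul_smul, mul_comm c',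
      mul_assoc]
  simp only [smul_mul_assoc, mul_smul_comm, h3]
  rw [smul_comm]

/-- Conjugating a theta operator over `P` by an automorphism `g` of `A` and a compatible field
automorphism `σ` gives a theta operator over `g P`. -/
theorem IsThetaOperator.exists_conj (σ : K ≃+* K) (g : A ≃+ A)
    (hσ : ∀ s ∈ V, (fun X => σ (s (g.symm X))) ∈ V) (hσ' : ∀ s ∈ V, (fun X => σ.symm (s (g X))) ∈ V)
    (hT : IsThetaOperator V P T) : ∃ T' : Module.End K V, IsThetaOperator V (g P) T' ∧
      ∀ s : V, ∀ X, (T' s : A → K) X = σ ((T ⟨_, hσ' s s.2⟩ : A → K) (g.symm X)) := by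
  refine ⟨{ toFun := fun s => ⟨_, hσ _ (T ⟨_, hσ' s s.2⟩).2⟩, map_add' := ?_, map_smul' := ?_ },
    ?_, fun s X => rfl⟩
  · intro s t
    ext X
    have : (⟨_, hσ' (s + t) (s + t).2⟩ : V) = ⟨_, hσ' s s.2⟩ + ⟨_, hσ' t t.2⟩ := by
      ext X; simp
    change σ ((T (⟨_, hσ' (s + t) (s + t).2⟩ : V) : A → K) (g.symm X)) = _
    rw [this, map_add]
    simp
  · intro c s
    ext X
    have : (⟨_, hσ' (c • s) (c • s).2⟩ : V) = σ.symm c • ⟨_, hσ' s s.2⟩ := by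
      ext X; simp
    change σ ((T (⟨_, hσ' (c • s) (c • s).2⟩ : V) : A → K) (g.symm X)) = _
    rw [this, map_smul]
    simp
  · obtain ⟨f, hf⟩ := hT
    refine ⟨fun X => σ (f (g.symm X)), ?_⟩
    filter_upwards [g.symm.injective.tendsto_cofinite.eventually hf] with X hX
    refine ⟨by simpa using hX.1, fun s => ?_⟩
    simp [hX.2]

/-- Conjugation is semilinear, so it turns the scalar `c` in `S T = c T S` into `σ c`. This is the
source of Galois equivariance. -/
theorem IsThetaCommutator.conj [IsAlgClosed K] [Infinite A] [FiniteDimensional K V]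
    [Nontrivial V] (hV : HasFinitelyManyZeros V) (σ : K ≃+* K) (g : A ≃+ A)
    (hσ : ∀ s ∈ V, (fun X => σ (s (g.symm X))) ∈ V) (hσ' : ∀ s ∈ V, (fun X => σ.symm (s (g X))) ∈ V)
    (hS : IsThetaOperator V P S) (hT : IsThetaOperator V Q T) {c d : K}
    (hc : IsThetaCommutator V P Q c) (hd : IsThetaCommutator V (g P) (g Q) d) : d = σ c := by
  obtain ⟨S', hS', hS2⟩ := hS.exists_conj σ g hσ hσ'
  obtain ⟨T', hT', hT2⟩ := hT.exists_conj σ g hσ hσ'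
  refine hd.eq_of_mul_eq hV hS' hT' ?_
  have h1 := hc.2 S T hS hT
  have key : ∀ (s : V), (⟨_, hσ' (S' s) (S' s).2⟩ : V) = S ⟨_, hσ' s s.2⟩ := by
    intro s; ext X; simp [hS2]
  have key' : ∀ (s : V), (⟨_, hσ' (T' s) (T' s).2⟩ : V) = T ⟨_, hσ' s s.2⟩ := by
    intro s; ext X; simp [hT2]
  ext s X
  have h2 := congrArg (fun R : Module.End K V => (R ⟨_, hσ' s s.2⟩ : A → K) (g.symm X)) h1
  simp only [Module.End.mul_apply, LinearMap.smul_apply, Submodule.coe_smul, Pi.smul_apply,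
    smul_eq_mul] at h2 ⊢
  rw [hS2, hT2, key, key', h2, map_mul]

/-- Commuting theta operators over `P` and `Q` have a common eigenvector, which is then an
eigenvector of every theta operator over the monoid generated by `P` and `Q`. -/
theorem IsThetaCommutator.exists_common_eigenvector [IsAlgClosed K] [Infinite A]
    [FiniteDimensional K V] [Nontrivial V] (hV : HasFinitelyManyZeros V)
    (hS : IsThetaOperator V P S) (hT : IsThetaOperator V Q T) (h : IsThetaCommutator V P Q 1) :
    ∃ s : V, s ≠ 0 ∧ ∀ R ∈ AddSubmonoid.closure {P, Q}, ∀ U : Module.End K V,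
      IsThetaOperator V R U → ∃ c : K, c ≠ 0 ∧ U s = c • s := by
  have hcomm : S * T = T * S := by simpa using h.2 S T hS hT
  obtain ⟨a, ha⟩ := Module.End.exists_eigenvalue S
  have hmaps : ∀ v ∈ S.eigenspace a, T v ∈ S.eigenspace a := by
    intro v hv
    rw [Module.End.mem_eigenspace_iff] at hv ⊢
    rw [← Module.End.mul_apply, hcomm, Module.End.mul_apply, hv, map_smul]
  have hnt : Nontrivial (S.eigenspace a) := Submodule.nontrivial_iff_ne_bot.mpr ha
  obtain ⟨b, hb⟩ := Module.End.exists_eigenvalue (K := K) (V := ↥(S.eigenspace a))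
    (T.restrict hmaps)
  obtain ⟨v, hv⟩ := hb.exists_hasEigenvector
  have hv0 : (v : V) ≠ 0 := by simpa using hv.2
  have hSv : S v = a • (v : V) := Module.End.mem_eigenspace_iff.mp v.2
  have hTv : T v = b • (v : V) := by
    have := congrArg Subtype.val hv.apply_eq_smul
    simpa using this
  have hne : ∀ {R : A} {U : Module.End K V} {c : K}, IsThetaOperator V R U → U v = c • (v : V) →
      c ≠ 0 := by
    rintro R U c hU hUv rfl
    exact hv0 (hU.injective hV (by rw [hUv, zero_smul, map_zero]))
  have hex : ∀ R ∈ AddSubmonoid.closure {P, Q}, ∃ U : Module.End K V, IsThetaOperator V R U ∧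
      ∃ c : K, U v = c • (v : V) := by
    intro R hR
    induction hR using AddSubmonoid.closure_induction with
    | mem x hx =>
      rcases hx with rfl | rfl
      · exact ⟨S, hS, a, hSv⟩
      · exact ⟨T, hT, b, hTv⟩
    | zero => exact ⟨1, .one, 1, by simp⟩
    | add x y _ _ hx hy =>
      obtain ⟨U, hU, c, hc⟩ := hx
      obtain ⟨U', hU', c', hc'⟩ := hy
      exact ⟨U * U', hU.mul hU', c' * c, by
        rw [Module.End.mul_apply, hc', map_smul, hc, smul_smul]⟩
  refine ⟨v, hv0, fun R hR U hU => ?_⟩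
  obtain ⟨U', hU', c, hc⟩ := hex R hR
  obtain ⟨d, -, rfl⟩ := hU.exists_eq_smul hV hU'
  have : (d • U') v = (d * c) • (v : V) := by rw [LinearMap.smul_apply, hc, smul_smul]
  exact ⟨d * c, hne hU this, this⟩

end ThetaOperators

/-! ### The `x`-coordinates of `P + Q` and `P - Q` -/

section MultiplicationPolynomials

open WeierstrassCurve WeierstrassCurve.Affine

variable {K : Type*} [Field K] [DecidableEq K] {W : Affine K}

theorem sym2x_add_sub_some_some {x₁ y₁ x₂ y₂ : K} (h₁ : W.Nonsingular x₁ y₁)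
    (h₂ : W.Nonsingular x₂ y₂) (hx : x₁ ≠ x₂) :
    ∃ c : K, c ≠ 0 ∧
      Point.sym2x (.some x₁ y₁ h₁ + .some x₂ y₂ h₂) (.some x₁ y₁ h₁ - .some x₂ y₂ h₂) =
        c • fun i => (addSubMap W i).eval (Point.sym2x (.some x₁ y₁ h₁) (.some x₂ y₂ h₂)) := by
  have hd : x₁ - x₂ ≠ 0 := sub_ne_zero.mpr hx
  have e1 := (equation_iff (W := W) ..).mp h₁.1
  have e2 := (equation_iff (W := W) ..).mp h₂.1
  refine ⟨((x₁ - x₂) ^ 2)⁻¹, inv_ne_zero (pow_ne_zero 2 hd), ?_⟩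
  rw [sub_eq_add_neg, Point.neg_some, Point.add_of_X_ne hx, Point.add_of_X_ne hx]
  ext i
  fin_cases i <;> simp [addSubMap, slope_of_X_ne hx, addX, negY, b₂, b₄, b₆, b₈]
  · generalize W.a₁ = a1, W.a₂ = a2, W.a₃ = a3, W.a₄ = a4, W.a₆ = a6 at *
    -- The two curve equations are linear in `a₄` and `a₆`. Solving for these leaves an identity of
    -- rational functions in free variables.
    obtain rfl : a6 = y₁ ^ 2 + a1 * x₁ * y₁ + a3 * y₁ - (x₁ ^ 3 + a2 * x₁ ^ 2 + a4 * x₁) := by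
      linear_combination -e1
    obtain rfl : a4 = ((y₁ ^ 2 + a1 * x₁ * y₁ + a3 * y₁ - (x₁ ^ 3 + a2 * x₁ ^ 2)) -
        (y₂ ^ 2 + a1 * x₂ * y₂ + a3 * y₂ - (x₂ ^ 3 + a2 * x₂ ^ 2))) / (x₁ - x₂) := by
      rw [eq_div_iff hd]
      linear_combination e2
    field_simp
    ring
  · field_simp
    grind
  · field_simp
    grind

theorem sym2x_add_self_zero [W.IsElliptic] (P : W.Point) :
    ∃ c : K, c ≠ 0 ∧ Point.sym2x (P + P) 0 =
      c • fun i => (addSubMap W i).eval (Point.sym2x P P) := by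
  rcases P with _ | ⟨x, y, h⟩
  · refine ⟨1, one_ne_zero, ?_⟩
    rw [← Point.zero_def]
    ext i
    fin_cases i <;> simp [addSubMap]
  have e := (equation_iff (W := W) ..).mp h.1
  by_cases hy : y = W.negY x y
  · have h0 := addSubMap_ne_zero W (Point.sym2x_ne_zero (.some x y h) (.some x y h))
    have h2 : (addSubMap W 2).eval (Point.sym2x (.some x y h) (.some x y h)) = 0 := by
      simp [addSubMap]; ring
    have h1 : (addSubMap W 1).eval (Point.sym2x (.some x y h) (.some x y h)) = 0 := by
      simp [addSubMap, b₂, b₄, b₆]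
      rw [negY] at hy
      linear_combination (-4) * e + (2 * y + W.a₁ * x + W.a₃) * hy
    rw [Point.add_self_of_Y_eq hy]
    have h3 : (addSubMap W 0).eval (Point.sym2x (.some x y h) (.some x y h)) ≠ 0 := by
      intro h3
      apply h0
      ext i
      fin_cases i
      exacts [h3, h1, h2]
    refine ⟨_, inv_ne_zero h3, ?_⟩
    ext i
    fin_cases i
    · simp only [Fin.zero_eta, Pi.smul_apply, smul_eq_mul, inv_mul_cancel₀ h3]
      simp
    · simp only [Fin.mk_one, Pi.smul_apply, smul_eq_mul, h1]
      simp
    · change _ = (_ : K) * (addSubMap W 2).eval _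
      rw [h2]
      simp
  · have hy' : y - W.negY x y ≠ 0 := sub_ne_zero.mpr hy
    refine ⟨((y - W.negY x y) ^ 2)⁻¹, inv_ne_zero (pow_ne_zero 2 hy'), ?_⟩
    rw [Point.add_self_of_Y_ne hy]
    ext i
    rw [negY] at hy'
    fin_cases i <;> simp [addSubMap, slope_of_Y_ne rfl hy, addX, b₂, b₄, b₆, b₈]
    all_goals
      generalize W.a₁ = a1, W.a₂ = a2, W.a₃ = a3, W.a₄ = a4, W.a₆ = a6 at *
      obtain rfl : a6 = y ^ 2 + a1 * x * y + a3 * y - (x ^ 3 + a2 * x ^ 2 + a4 * x) := by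
        linear_combination -e
      obtain ⟨D, hD⟩ : ∃ D, D = y - (-y - a1 * x - a3) := ⟨_, rfl⟩
      rw [← hD] at hy' ⊢
      obtain rfl : a3 = D - 2 * y - a1 * x := by linear_combination -hD
    · field_simp
      ring
    · field_simp
      ring
    · right
      ring

theorem sym2x_add_sub [W.IsElliptic] (P Q : W.Point) :
    ∃ c : K, c ≠ 0 ∧ Point.sym2x (P + Q) (P - Q) =
      c • fun i => (addSubMap W i).eval (Point.sym2x P Q) := by
  by_cases hPQ : P = Q
  · subst hPQ
    simpa using sym2x_add_self_zero P
  by_cases hPQ' : P = -Q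
  · subst hPQ'
    obtain ⟨c, hc, h⟩ := sym2x_add_self_zero Q
    refine ⟨c, hc, ?_⟩
    rw [Point.sym2x_neg_left, ← h, neg_add_cancel, Point.sym2x_comm, ← neg_add',
      Point.sym2x_neg_left]
  rcases P with _ | ⟨x₁, y₁, h₁⟩
  · refine ⟨1, one_ne_zero, ?_⟩
    rw [← Point.zero_def, zero_add, zero_sub, Point.sym2x_neg_right]
    rcases Q with _ | ⟨x, y, h⟩
    · exact absurd rfl hPQ
    ext i
    fin_cases i <;> simp [addSubMap] <;> ring
  rcases Q with _ | ⟨x₂, y₂, h₂⟩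
  · refine ⟨1, one_ne_zero, ?_⟩
    rw [← Point.zero_def, add_zero, sub_zero]
    ext i
    fin_cases i <;> simp [addSubMap] <;> ring
  refine sym2x_add_sub_some_some h₁ h₂ fun hx => ?_
  rcases Point.X_eq_iff.mp hx with h | h
  exacts [hPQ h, hPQ' h]

end MultiplicationPolynomials

/-! ### Multiplication by `n` as a rational function of `x` -/

section MultiplicationPolynomials

open WeierstrassCurve WeierstrassCurve.Affine Polynomial

variable {K : Type*} [Field K]

variable {W : Affine K}

theorem exists_nonsingular [IsAlgClosed K] [W.IsElliptic] (x : K) : ∃ y, W.Nonsingular x y := by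
  obtain ⟨y, hy⟩ := IsAlgClosed.exists_root
    (X ^ 2 + C (W.a₁ * x + W.a₃) * X - C (x ^ 3 + W.a₂ * x ^ 2 + W.a₄ * x + W.a₆)) (by
      have : (X ^ 2 + C (W.a₁ * x + W.a₃) * X -
        C (x ^ 3 + W.a₂ * x ^ 2 + W.a₄ * x + W.a₆)).degree = 2 := by compute_degree!
      rw [this]; decide)
  refine ⟨y, (equation_iff_nonsingular (W := W)).mp ((equation_iff (W := W) ..).mpr ?_)⟩
  simp only [IsRoot.def, eval_sub, eval_add, eval_mul, eval_pow, eval_X, eval_C] at hy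
  linear_combination hy

theorem exists_smul_of_cross {α β c d : K} (h0 : ¬(α = 0 ∧ β = 0)) (h1 : ¬(c = 0 ∧ d = 0))
    (h : α * d = β * c) : ∃ k : K, k ≠ 0 ∧ c = k * α ∧ d = k * β := by
  by_cases hα : α = 0
  · have hβ : β ≠ 0 := fun hβ => h0 ⟨hα, hβ⟩
    have hc : c = 0 := by
      have : β * c = 0 := by rw [← h, hα, zero_mul]
      exact (mul_eq_zero.mp this).resolve_left hβ
    have hd : d ≠ 0 := fun hd => h1 ⟨hc, hd⟩
    exact ⟨d / β, div_ne_zero hd hβ, by rw [hc, hα, mul_zero], (div_mul_cancel₀ d hβ).symm⟩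
  · have hc : c ≠ 0 := by
      rintro rfl
      exact h1 ⟨rfl, (mul_eq_zero.mp (h.trans (mul_zero β))).resolve_left hα⟩
    refine ⟨c / α, div_ne_zero hc hα, (div_mul_cancel₀ c hα).symm, ?_⟩
    field_simp
    linear_combination h

theorem Point.not_xRep_eq_zero (P : W.Point) : ¬(P.xRep 0 = 0 ∧ P.xRep 1 = 0) := by
  rintro ⟨h0, h1⟩
  apply P.xRep_ne_zero
  ext i
  fin_cases i
  exacts [h0, h1]

theorem IsCoprime.not_eval_eq_zero {a b : K[X]} (h : IsCoprime a b) (x : K) :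
    ¬(a.eval x = 0 ∧ b.eval x = 0) := by
  rintro ⟨h0, h1⟩
  obtain ⟨u, v, huv⟩ := h
  simpa [h0, h1] using congrArg (eval x) huv

variable [DecidableEq K]

/-- Coprime polynomials `a` and `b` such that multiplication by `n` on `W` is `a / b` on
`x`-coordinates. -/
structure IsMultiplicationPair (W : Affine K) (n : ℕ) (a b : K[X]) : Prop where
  isCoprime : IsCoprime a b
  monic : a.Monic
  natDegree_left : a.natDegree = n ^ 2
  natDegree_right : b.natDegree ≤ n ^ 2 - 1
  right_eq_zero : n = 0 → b = 0
  xRep_nsmul (x y : K) (h : W.Nonsingular x y) :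
    (n • Point.some x y h).xRep 0 * b.eval x = (n • Point.some x y h).xRep 1 * a.eval x

theorem IsMultiplicationPair.zero : IsMultiplicationPair W 0 1 0 where
  isCoprime := isCoprime_one_left
  monic := monic_one
  natDegree_left := by simp
  natDegree_right := by simp
  right_eq_zero _ := rfl
  xRep_nsmul x y h := by simp

theorem IsMultiplicationPair.one : IsMultiplicationPair W 1 X 1 where
  isCoprime := isCoprime_one_right
  monic := monic_X
  natDegree_left := by simp
  natDegree_right := by simp
  right_eq_zero h := by simp at h
  xRep_nsmul x y h := by simp

/-- Splitting off the known factor `a' W - b' Z` from a binary quadratic form over `K[X]`. -/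
theorem exists_cofactor {a' b' s t u : K[X]} (hc : IsCoprime a' b') (ha : a'.Monic)
    (h : s * b' ^ 2 - t * (a' * b') + u * a' ^ 2 = 0) :
    ∃ a b, s = a' * a ∧ t = a * b' + b * a' ∧ u = b' * b := by
  by_cases hb : b' = 0
  · subst hb
    have ha1 : a' = 1 := ha.eq_one_of_isUnit (isCoprime_zero_right.mp hc)
    subst ha1
    exact ⟨s, t, by ring, by ring, by linear_combination h⟩
  · have h1 : a' ∣ s := by
      refine (hc.pow_right (n := 2)).dvd_of_dvd_mul_right ⟨t * b' - u * a', ?_⟩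
      linear_combination h
    have h2 : b' ∣ u := by
      refine (hc.symm.pow_right (n := 2)).dvd_of_dvd_mul_right ⟨t * a' - s * b', ?_⟩
      linear_combination h
    obtain ⟨a, rfl⟩ := h1
    obtain ⟨b, rfl⟩ := h2
    refine ⟨a, b, rfl, ?_, rfl⟩
    have h3 : a' * b' ≠ 0 := mul_ne_zero ha.ne_zero hb
    refine mul_left_cancel₀ h3 ?_
    linear_combination -h

/-- The recursive step: the numerator and denominator of `x((n + 2) P)` are read off from
`x((n + 1) P)` and `x(n P)`. -/
theorem IsMultiplicationPair.step [IsAlgClosed K] [W.IsElliptic] {n : ℕ} {a b a' b' : K[X]}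
    (h' : IsMultiplicationPair W n a' b') (h : IsMultiplicationPair W (n + 1) a b) :
    ∃ a'' b'', IsMultiplicationPair W (n + 2) a'' b'' := by
  -- `s, t, u` are the biquadratic forms at the pair `(a : b)`, `(X : 1)`. Hence `s W² - t Z W + u
  -- Z²` is the binary form whose roots `(Z : W)` are `x((n + 2)P)` and `x(nP)`.
  set s : K[X] := (a * X) ^ 2 -
    (C W.b₄ * (a * X) * b + C W.b₆ * (a + b * X) * b + C W.b₈ * b ^ 2) with hs
  set t : K[X] := C 2 * (a + b * X) * (a * X) + C W.b₂ * (a * X) * b + C W.b₄ * (a + b * X) * b +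
    C W.b₆ * b ^ 2 with ht
  set u : K[X] := (a + b * X) ^ 2 - C 4 * (a * X) * b with hu
  have key : ∀ (x y : K) (hxy : W.Nonsingular x y), ∃ k : K, k ≠ 0 ∧
      s.eval x = k * (((n + 2) • Point.some x y hxy).xRep 0 * (n • Point.some x y hxy).xRep 0) ∧
      t.eval x = k * (((n + 2) • Point.some x y hxy).xRep 0 * (n • Point.some x y hxy).xRep 1 +
        ((n + 2) • Point.some x y hxy).xRep 1 * (n • Point.some x y hxy).xRep 0) ∧
      u.eval x = k * (((n + 2) • Point.some x y hxy).xRep 1 * (n • Point.some x y hxy).xRep 1) := by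
    intro x y hxy
    obtain ⟨m, hm, hma, hmb⟩ := exists_smul_of_cross (Point.not_xRep_eq_zero _)
      (h.isCoprime.not_eval_eq_zero x) (h.xRep_nsmul x y hxy)
    obtain ⟨c, hc, hadd⟩ := sym2x_add_sub ((n + 1) • Point.some x y hxy) (Point.some x y hxy)
    have e1 : (n + 1) • Point.some x y hxy + Point.some x y hxy = (n + 2) • Point.some x y hxy := by
      rw [← succ_nsmul]
    have e2 : (n + 1) • Point.some x y hxy - Point.some x y hxy = n • Point.some x y hxy := by
      rw [succ_nsmul, add_sub_cancel_right]
    rw [e1, e2] at hadd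
    have a0 := congrFun hadd 0
    have a1 := congrFun hadd 1
    have a2 := congrFun hadd 2
    simp only [Point.sym2x, addSubMap, Point.xRep_some, Pi.smul_apply, smul_eq_mul,
      Matrix.cons_val_zero, Matrix.cons_val_one, Matrix.cons_val, map_sub, map_add, map_mul,
      map_pow, MvPolynomial.eval_X, MvPolynomial.eval_C, mul_one] at a0 a1 a2
    refine ⟨m ^ 2 * c⁻¹, mul_ne_zero (pow_ne_zero 2 hm) (inv_ne_zero hc), ?_, ?_, ?_⟩
    · simp only [hs, eval_sub, eval_add, eval_mul, eval_pow, eval_X, eval_C, hma, hmb, a0]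
      field_simp
      ring
    · simp only [ht, eval_add, eval_mul, eval_pow, eval_X, eval_C, hma, hmb, a1]
      field_simp
    · simp only [hu, eval_sub, eval_add, eval_mul, eval_pow, eval_X, eval_C, hma, hmb, a2]
      field_simp
  -- The root `x(nP) = (a' : b')` is known. Dividing it out leaves `(a'' : b'')`, which represents
  -- the other root.
  have hrel : s * b' ^ 2 - t * (a' * b') + u * a' ^ 2 = 0 := by
    refine Polynomial.funext fun x => ?_
    obtain ⟨y, hxy⟩ := exists_nonsingular (W := W) x
    obtain ⟨k, -, h1, h2, h3⟩ := key x y hxy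
    have h4 := h'.xRep_nsmul x y hxy
    simp only [eval_add, eval_sub, eval_mul, eval_pow, eval_zero, h1, h2, h3]
    generalize (n • Point.some x y hxy).xRep 0 = α' at *
    generalize (n • Point.some x y hxy).xRep 1 = β' at *
    generalize ((n + 2) • Point.some x y hxy).xRep 0 = α at *
    generalize ((n + 2) • Point.some x y hxy).xRep 1 = β at *
    linear_combination (k * α * eval x b' - k * β * eval x a') * h4
  obtain ⟨a'', b'', hsa, hta, hua⟩ := exists_cofactor h'.isCoprime h'.monic hrel
  have hnd : (a * X).natDegree = (n + 1) ^ 2 + 1 := by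
    rw [natDegree_mul_X h.monic.ne_zero, h.natDegree_left]
  have hb : b.natDegree ≤ n ^ 2 + 2 * n := by
    have := h.natDegree_right
    rw [show (n + 1) ^ 2 - 1 = n ^ 2 + 2 * n by rw [add_sq]; omega] at this
    exact this
  have ha : a.natDegree = n ^ 2 + 2 * n + 1 := by rw [h.natDegree_left]; ring
  have hbX : (a + b * X).natDegree ≤ n ^ 2 + 2 * n + 1 := by
    refine natDegree_add_le_of_degree_le ha.le (natDegree_mul_le.trans ?_)
    have := natDegree_X_le (R := K)
    omega
  have haX : (a * X).natDegree ≤ n ^ 2 + 2 * n + 2 := by rw [hnd]; ring_nf; rfl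
  have mul_bound : ∀ {p q : K[X]} {i j l : ℕ}, p.natDegree ≤ i → q.natDegree ≤ j → i + j ≤ l →
      (p * q).natDegree ≤ l := fun hp hq hl => natDegree_mul_le.trans ((add_le_add hp hq).trans hl)
  have C_bound : ∀ {c : K} {p : K[X]} {i : ℕ}, p.natDegree ≤ i → (C c * p).natDegree ≤ i :=
    fun hp => (natDegree_C_mul_le _ _).trans hp
  have hb2 : (b ^ 2).natDegree ≤ 2 * (n ^ 2 + 2 * n) := natDegree_pow_le_of_le 2 hb
  have hs_monic : s.Monic ∧ s.natDegree = 2 * (n ^ 2 + 2 * n) + 4 := by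
    have h1 : ((a * X) ^ 2).Monic := (h.monic.mul monic_X).pow 2
    have h2 : ((a * X) ^ 2).natDegree = 2 * (n ^ 2 + 2 * n) + 4 := by
      rw [natDegree_pow, hnd]; ring
    have h3 : (C W.b₄ * (a * X) * b + C W.b₆ * (a + b * X) * b + C W.b₈ * b ^ 2).natDegree ≤
        2 * (n ^ 2 + 2 * n) + 2 := by
      refine natDegree_add_le_of_degree_le (natDegree_add_le_of_degree_le ?_ ?_) ?_
      · exact mul_bound (C_bound haX) hb (by omega)
      · exact mul_bound (C_bound hbX) hb (by omega)
      · exact C_bound (hb2.trans (by omega))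
    have h4 : (C W.b₄ * (a * X) * b + C W.b₆ * (a + b * X) * b + C W.b₈ * b ^ 2).degree <
        ((a * X) ^ 2).degree := degree_lt_degree (by omega)
    refine ⟨h1.sub_of_left h4, ?_⟩
    rw [hs, natDegree_sub_eq_left_of_natDegree_lt (by omega), h2]
  have ht_deg : t.natDegree ≤ 2 * (n ^ 2 + 2 * n) + 3 := by
    refine natDegree_add_le_of_degree_le (natDegree_add_le_of_degree_le
      (natDegree_add_le_of_degree_le ?_ ?_) ?_) ?_
    · exact mul_bound (C_bound hbX) haX (by omega)
    · exact mul_bound (C_bound haX) hb (by omega)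
    · exact mul_bound (C_bound hbX) hb (by omega)
    · exact C_bound (hb2.trans (by omega))
  have ha''_monic : a''.Monic := by
    have := hs_monic.1
    rw [hsa] at this
    exact h'.monic.of_mul_monic_left this
  have ha''_deg : a''.natDegree = (n + 2) ^ 2 := by
    have := hs_monic.2
    rw [hsa, h'.monic.natDegree_mul ha''_monic, h'.natDegree_left] at this
    rw [add_sq]
    omega
  have hab' : (a'' * b').natDegree ≤ 2 * (n ^ 2 + 2 * n) + 3 := by
    -- At `n = 0` the truncated bound `n ^ 2 - 1` is too weak by one; the field `right_eq_zero`
    -- covers this case.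
    rcases Nat.eq_zero_or_pos n with h0 | h0
    · rw [h'.right_eq_zero h0, mul_zero, natDegree_zero]
      exact Nat.zero_le _
    · refine mul_bound ha''_deg.le h'.natDegree_right ?_
      have : 0 < n ^ 2 := by positivity
      rw [add_sq]
      omega
  refine ⟨a'', b'', ?_, ha''_monic, ha''_deg, ?_, by omega, ?_⟩
  -- A common zero of `a''` and `b''` would kill `s, t, u` together, hence all symmetric coordinates
  -- of a pair of projective points, which is impossible.
  · rw [Polynomial.isCoprime_iff_aeval_ne_zero_of_isAlgClosed K K]
    intro x
    by_contra! hx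
    simp only [coe_aeval_eq_eval] at hx
    obtain ⟨y, hxy⟩ := exists_nonsingular (W := W) x
    obtain ⟨k, hk, h1, h2, h3⟩ := key x y hxy
    rw [hsa, eval_mul, hx.1, mul_zero, eq_comm, mul_eq_zero, or_iff_right hk] at h1
    rw [hua, eval_mul, hx.2, mul_zero, eq_comm, mul_eq_zero, or_iff_right hk] at h3
    rw [hta, eval_add, eval_mul, eval_mul, hx.1, hx.2, zero_mul, zero_mul, add_zero, eq_comm,
      mul_eq_zero, or_iff_right hk] at h2
    apply Point.sym2x_ne_zero ((n + 2) • Point.some x y hxy) (n • Point.some x y hxy)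
    ext i
    fin_cases i
    exacts [h1, h2, h3]
  · have h1 : (a' * b'').natDegree ≤ 2 * (n ^ 2 + 2 * n) + 3 := by
      have : a' * b'' = t - a'' * b' := by rw [hta]; ring
      rw [this]
      exact (natDegree_sub_le_of_le ht_deg hab').trans (max_self _).le
    by_cases hb'' : b'' = 0
    · simp [hb'']
    rw [h'.monic.natDegree_mul' hb'', h'.natDegree_left] at h1
    rw [add_sq]
    omega
  · intro x y hxy
    obtain ⟨k, hk, h1, h2, h3⟩ := key x y hxy
    obtain ⟨m, hm, hma, hmb⟩ := exists_smul_of_cross (Point.not_xRep_eq_zero _)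
      (h'.isCoprime.not_eval_eq_zero x) (h'.xRep_nsmul x y hxy)
    have h0 := Point.not_xRep_eq_zero (n • Point.some x y hxy)
    rw [hsa, eval_mul, hma] at h1
    rw [hua, eval_mul, hmb] at h3
    rw [hta, eval_add, eval_mul, eval_mul, hma, hmb] at h2
    generalize (n • Point.some x y hxy).xRep 0 = α' at *
    generalize (n • Point.some x y hxy).xRep 1 = β' at *
    generalize ((n + 2) • Point.some x y hxy).xRep 0 = α at *
    generalize ((n + 2) • Point.some x y hxy).xRep 1 = β at *
    by_cases hα' : α' = 0
    · have hβ' : β' ≠ 0 := fun hβ' => h0 ⟨hα', hβ'⟩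
      subst hα'
      refine mul_left_cancel₀ (mul_ne_zero hk (mul_ne_zero hβ' hβ')) ?_
      refine mul_left_cancel₀ hm ?_
      linear_combination α * k * β' * h3 - β * k * β' * h2
    · refine mul_left_cancel₀ (mul_ne_zero hk (mul_ne_zero hα' hα')) ?_
      refine mul_left_cancel₀ hm ?_
      linear_combination k * α * α' * h2 - (k * β * α' + k * α * β') * h1

theorem exists_isMultiplicationPair (W : Affine K) [IsAlgClosed K] [W.IsElliptic] (n : ℕ) :
    ∃ a b, IsMultiplicationPair W n a b := by
  have : (∃ a b, IsMultiplicationPair W n a b) ∧ ∃ a b, IsMultiplicationPair W (n + 1) a b := by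
    induction n with
    | zero => exact ⟨⟨_, _, .zero⟩, _, _, .one⟩
    | succ n ih =>
      obtain ⟨⟨a', b', h'⟩, a, b, h⟩ := ih
      exact ⟨⟨a, b, h⟩, h'.step h⟩
  exact this.1

end MultiplicationPolynomials

/-! ### Divisibility of the group of points and the number of torsion points -/

section MultiplicationPolynomials

open WeierstrassCurve WeierstrassCurve.Affine Polynomial

variable {K : Type*} [Field K] [DecidableEq K] {W : Affine K}

/-- A root of `a - xT b` is the abscissa of a point whose `n`-th multiple is `T` up to sign;
negating the point corrects the sign. -/
theorem IsMultiplicationPair.exists_nsmul_eq [IsAlgClosed K] [W.IsElliptic] {n : ℕ} {a b : K[X]}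
    (hab : IsMultiplicationPair W n a b) {x xT yT : K} (hT : W.Nonsingular xT yT)
    (hx : (a - C xT * b).eval x = 0) :
    ∃ (y : K) (h : W.Nonsingular x y), n • Point.some x y h = Point.some xT yT hT := by
  obtain ⟨y, h⟩ := exists_nonsingular (W := W) x
  have h1 := hab.xRep_nsmul x y h
  simp only [eval_sub, eval_mul, eval_C, sub_eq_zero] at hx
  have hb : b.eval x ≠ 0 := fun hb =>
    hab.isCoprime.not_eval_eq_zero x ⟨by rw [hx, hb, mul_zero], hb⟩
  have h2 : (n • Point.some x y h).xRep 0 = (n • Point.some x y h).xRep 1 * xT := by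
    refine mul_right_cancel₀ hb ?_
    rw [h1, hx, mul_assoc]
  have h3 : (n • Point.some x y h).xRep = (Point.some xT yT hT).xRep := by
    generalize n • Point.some x y h = P at *
    rcases P with _ | ⟨x', y', h'⟩
    · simp [← Point.zero_def] at h2
    · simpa using h2
  rcases Point.eq_or_eq_neg_of_xRep_eq_xRep h3 with h4 | h4
  · exact ⟨y, h, h4⟩
  · refine ⟨W.negY x y, (nonsingular_neg ..).mpr h, ?_⟩
    rw [← Point.neg_some h, smul_neg, h4, neg_neg]

theorem IsMultiplicationPair.natDegree_sub [W.IsElliptic] {n : ℕ} (hn : n ≠ 0) {a b : K[X]}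
    (hab : IsMultiplicationPair W n a b) (c : K) : (a - C c * b).natDegree = n ^ 2 := by
  have h1 : (C c * b).natDegree < a.natDegree := by
    refine ((natDegree_C_mul_le c b).trans hab.natDegree_right).trans_lt ?_
    rw [hab.natDegree_left]
    have : 0 < n ^ 2 := by positivity
    omega
  rw [natDegree_sub_eq_left_of_natDegree_lt h1, hab.natDegree_left]

theorem Point.exists_nsmul_eq [IsAlgClosed K] [W.IsElliptic] {n : ℕ} (hn : n ≠ 0) (T : W.Point) :
    ∃ P : W.Point, n • P = T := by
  rcases T with _ | ⟨xT, yT, hT⟩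
  · exact ⟨0, smul_zero n⟩
  obtain ⟨a, b, hab⟩ := exists_isMultiplicationPair W n
  have hd := hab.natDegree_sub hn xT
  obtain ⟨x, hx⟩ := IsAlgClosed.exists_root (a - C xT * b) (by
    intro h0
    rw [natDegree_eq_of_degree_eq_some h0] at hd
    exact pow_ne_zero 2 hn hd.symm)
  obtain ⟨y, h, hy⟩ := hab.exists_nsmul_eq hT hx
  exact ⟨_, hy⟩

/-- If the Wronskian vanished, coprimality would give `a ∣ a'`, so `a' = 0` by degree, which in
characteristic zero contradicts `deg a = n² > 0`. -/
theorem IsMultiplicationPair.wronskian_ne_zero [CharZero K] {n : ℕ} (hn : n ≠ 0)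
    {a b : K[X]} (hab : IsMultiplicationPair W n a b) :
    derivative a * b - a * derivative b ≠ 0 := by
  intro h
  have h1 : a ∣ derivative a :=
    hab.isCoprime.dvd_of_dvd_mul_right ⟨derivative b, by linear_combination h⟩
  have hd : 0 < a.natDegree := by rw [hab.natDegree_left]; positivity
  have h2 : derivative a = 0 := by
    refine eq_zero_of_dvd_of_natDegree_lt h1 (natDegree_derivative_lt hd.ne')
  exact hd.ne' (derivative_eq_zero.mp h2)

theorem Point.exists_torsion_finset [IsAlgClosed K] [CharZero K] [W.IsElliptic] {n : ℕ}
    (hn : n ≠ 0) : ∃ s : Finset W.Point, s.card = n ^ 2 ∧ ∀ P ∈ s, n • P = 0 := by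
  obtain ⟨a, b, hab⟩ := exists_isMultiplicationPair W n
  set w := derivative a * b - a * derivative b with hw
  have hw0 : w ≠ 0 := hab.wronskian_ne_zero hn
  -- `xT` avoids the critical values of `a / b`: a multiple root of `a - xT b` would be a zero of
  -- the Wronskian.
  obtain ⟨xT, hxT⟩ := Infinite.exists_notMem_finset (w.roots.toFinset.image fun c => a.eval c / b.eval c)
  obtain ⟨yT, hT⟩ := exists_nonsingular (W := W) xT
  set q := a - C xT * b with hq
  have hq0 : q ≠ 0 := by
    intro h0
    have := hab.natDegree_sub hn xT
    rw [← hq, h0, natDegree_zero] at this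
    exact pow_ne_zero 2 hn this.symm
  have hsep : q.Separable := by
    rw [Separable, Polynomial.isCoprime_iff_aeval_ne_zero_of_isAlgClosed K K]
    intro c
    by_contra! hc
    simp only [coe_aeval_eq_eval, hq, derivative_sub, derivative_C_mul, eval_sub, eval_mul, eval_C,
      sub_eq_zero] at hc
    have hb : b.eval c ≠ 0 := fun hb =>
      hab.isCoprime.not_eval_eq_zero c ⟨by rw [hc.1, hb, mul_zero], hb⟩
    apply hxT
    refine Finset.mem_image.mpr ⟨c, ?_, by rw [hc.1, mul_div_cancel_right₀ _ hb]⟩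
    rw [Multiset.mem_toFinset, mem_roots hw0, IsRoot.def, hw]
    simp only [eval_sub, eval_mul, hc.1, hc.2]
    ring
  have hcard : q.roots.toFinset.card = n ^ 2 := by
    rw [Multiset.toFinset_card_of_nodup (nodup_roots hsep),
      ← (IsAlgClosed.splits q).natDegree_eq_card_roots, hab.natDegree_sub hn]
  have hex : ∀ x ∈ q.roots.toFinset, ∃ P : W.Point, n • P = .some xT yT hT ∧ P.xRep 0 = x := by
    intro x hx
    obtain ⟨y, h, hy⟩ := hab.exists_nsmul_eq hT ((mem_roots hq0).mp (Multiset.mem_toFinset.mp hx))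
    exact ⟨_, hy, rfl⟩
  choose! f hf hf' using hex
  have hne : q.roots.toFinset.Nonempty := by
    rw [← Finset.card_pos, hcard]; positivity
  obtain ⟨x₀, hx₀⟩ := hne
  -- The fibre over `T` is moved onto the kernel by subtracting one of its points.
  refine ⟨q.roots.toFinset.image fun x => f x - f x₀, ?_, ?_⟩
  · rw [Finset.card_image_of_injOn, hcard]
    intro x hx x' hx' h
    have h2 : f x = f x' := sub_left_injective h
    rw [← hf' x hx, ← hf' x' hx', h2]
  · intro P hP
    obtain ⟨x, hx, rfl⟩ := Finset.mem_image.mp hP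
    rw [smul_sub, hf x hx, hf x₀ hx₀, sub_self]

end MultiplicationPolynomials

/-! ### Regular functions and pole orders at infinity -/

section RegularFunctions

open WeierstrassCurve WeierstrassCurve.Affine WeierstrassCurve.Affine.CoordinateRing Polynomial
open scoped Polynomial.Bivariate

variable {K : Type*} [Field K] {W : Affine K}

/-- Evaluation of a regular function at an affine point. -/
noncomputable def evalAt {x y : K} (h : W.Equation x y) : W.CoordinateRing →+* K :=
  AdjoinRoot.evalEval h

theorem evalAt_mk {x y : K} (h : W.Equation x y) (f : K[X][Y]) :
    evalAt h (CoordinateRing.mk W f) = f.evalEval x y :=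
  AdjoinRoot.evalEval_mk h f

/-- Evaluation of a regular function at a point, with the convention that the value at the point at
infinity is zero. -/
noncomputable def evalPoint (W : Affine K) : W.CoordinateRing →ₗ[K] (W.Point → K) where
  toFun f P := match P with
    | 0 => 0
    | .some _ _ h => evalAt h.1 f
  map_add' f g := by
    ext P
    rcases P with _ | ⟨x, y, h⟩
    · exact (add_zero 0).symm
    · exact map_add (evalAt h.1) f g
  map_smul' c f := by
    ext P
    rcases P with _ | ⟨x, y, h⟩
    · exact (mul_zero c).symm
    · change evalAt h.1 (c • f) = c * evalAt h.1 f
      have : c • f = CoordinateRing.mk W (C (C c)) * f := by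
        rw [Algebra.smul_def]; rfl
      rw [this, map_mul, evalAt_mk, evalEval_C, eval_C]

@[simp]
theorem evalPoint_some (f : W.CoordinateRing) {x y : K} (h : W.Nonsingular x y) :
    evalPoint W f (.some x y h) = evalAt h.1 f := rfl

theorem exists_mk_eq (f : W.CoordinateRing) :
    ∃ p q : K[X], f = CoordinateRing.mk W (C p + C q * Y) := by
  obtain ⟨p, q, rfl⟩ := exists_smul_basis_eq f
  exact ⟨p, q, by rw [CoordinateRing.smul, CoordinateRing.smul, mul_one, map_add, map_mul]⟩

theorem mk_eq_smul_basis (p q : K[X]) :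
    CoordinateRing.mk W (C p + C q * Y) = p • (1 : W.CoordinateRing) + q • CoordinateRing.mk W Y := by
  rw [CoordinateRing.smul, CoordinateRing.smul, mul_one, map_add, map_mul]

theorem evalEval_mk_C_add_C_mul_Y {x y : K} (h : W.Equation x y) (p q : K[X]) :
    evalAt h (CoordinateRing.mk W (C p + C q * Y)) = p.eval x + q.eval x * y := by
  rw [evalAt_mk]
  simp [evalEval]

/-- The value of the norm of `f` at `x` is the product of the values of `f` at the two points above
`x`. -/
theorem eval_norm {x y : K} (h : W.Equation x y) (f : W.CoordinateRing) :
    (Algebra.norm K[X] f).eval x = evalAt h f *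
      evalAt ((equation_neg (W' := W) x y).mpr h) f := by
  obtain ⟨p, q, rfl⟩ := exists_mk_eq f
  rw [evalEval_mk_C_add_C_mul_Y, evalEval_mk_C_add_C_mul_Y, mk_eq_smul_basis, norm_smul_basis]
  simp only [eval_sub, eval_mul, eval_pow, eval_add, eval_X, eval_C, negY]
  have e := (equation_iff (W := W) ..).mp h
  linear_combination (eval x q) ^ 2 * e

theorem norm_ne_zero {f : W.CoordinateRing} (hf : f ≠ 0) : Algebra.norm K[X] f ≠ 0 :=
  (Algebra.norm_ne_zero_iff_of_basis (CoordinateRing.basis W)).mpr hf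

theorem norm_XClass (x : K) : Algebra.norm K[X] (XClass W x) = (X - C x) ^ 2 := by
  have : XClass W x = (X - C x) • (1 : W.CoordinateRing) + (0 : K[X]) • CoordinateRing.mk W Y := by
    rw [← mk_eq_smul_basis, XClass]
    simp
  rw [this, norm_smul_basis]
  ring

theorem two_nsmul_degree_le {p : K[X]} {n : ℕ} :
    2 • p.degree ≤ (n : WithBot ℕ) ↔ p = 0 ∨ 2 * p.natDegree ≤ n := by
  by_cases hp : p = 0
  · simp only [hp, degree_zero, true_or, iff_true]
    exact bot_le
  · rw [degree_eq_natDegree hp, or_iff_right hp, two_nsmul, two_mul]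
    norm_cast

theorem two_nsmul_degree_add_three_le {p : K[X]} {n : ℕ} :
    2 • p.degree + 3 ≤ (n : WithBot ℕ) ↔ p = 0 ∨ 2 * p.natDegree + 3 ≤ n := by
  by_cases hp : p = 0
  · simp only [hp, degree_zero, true_or, iff_true]
    exact bot_le
  · rw [degree_eq_natDegree hp, or_iff_right hp, two_nsmul, two_mul]
    norm_cast

/-- The degree of the norm is the pole order at infinity. With `x` of order 2 and `y` of order 3,
the terms `p` and `q y` have orders of different parity and cannot cancel. -/
theorem degree_norm_le_iff {p q : K[X]} {n : ℕ} :
    (Algebra.norm K[X] (CoordinateRing.mk W (C p + C q * Y))).degree ≤ n ↔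
      (p = 0 ∨ 2 * p.natDegree ≤ n) ∧ (q = 0 ∨ 2 * q.natDegree + 3 ≤ n) := by
  rw [mk_eq_smul_basis, degree_norm_smul_basis, max_le_iff, two_nsmul_degree_le,
    two_nsmul_degree_add_three_le]

/-- The regular functions with a pole of order at most `n` at infinity. -/
noncomputable def poleBounded (W : Affine K) (n : ℕ) : Submodule K W.CoordinateRing where
  carrier := {f | (Algebra.norm K[X] f).degree ≤ n}
  zero_mem' := by
    change (Algebra.norm K[X] (0 : W.CoordinateRing)).degree ≤ n
    have : (0 : W.CoordinateRing) = CoordinateRing.mk W (C 0 + C 0 * Y) := by simp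
    rw [this, degree_norm_le_iff]
    simp
  add_mem' := by
    intro f g hf hg
    obtain ⟨p, q, rfl⟩ := exists_mk_eq f
    obtain ⟨p', q', rfl⟩ := exists_mk_eq g
    simp only [Set.mem_ofPred_eq] at *
    have : CoordinateRing.mk W (C p + C q * Y) + CoordinateRing.mk W (C p' + C q' * Y) =
        CoordinateRing.mk W (C (p + p') + C (q + q') * Y) := by
      rw [← map_add]; congr 1; simp only [C_add]; ring
    rw [degree_norm_le_iff] at hf hg
    rw [this, degree_norm_le_iff]
    have h1 := natDegree_add_le p p'
    have h2 := natDegree_add_le q q'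
    refine ⟨?_, ?_⟩
    · rcases hf.1 with rfl | h3
      · simpa using hg.1
      rcases hg.1 with rfl | h4
      · right; simpa using h3
      right
      omega
    · rcases hf.2 with rfl | h3
      · simpa using hg.2
      rcases hg.2 with rfl | h4
      · right; simpa using h3
      right
      omega
  smul_mem' := by
    intro c f hf
    obtain ⟨p, q, rfl⟩ := exists_mk_eq f
    simp only [Set.mem_ofPred_eq] at *
    have : c • CoordinateRing.mk W (C p + C q * Y) =
        CoordinateRing.mk W (C (C c * p) + C (C c * q) * Y) := by
      rw [Algebra.smul_def]
      change CoordinateRing.mk W (C (C c)) * _ = _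
      rw [← map_mul]; congr 1; simp only [C_mul]; ring
    rw [degree_norm_le_iff] at hf
    rw [this, degree_norm_le_iff]
    have h1 := natDegree_C_mul_le c p
    have h2 := natDegree_C_mul_le c q
    refine ⟨hf.1.imp (fun h => by simp [h]) (by omega), hf.2.imp (fun h => by simp [h]) (by omega)⟩

theorem mem_poleBounded {f : W.CoordinateRing} {n : ℕ} :
    f ∈ poleBounded W n ↔ (Algebra.norm K[X] f).degree ≤ n := Iff.rfl

theorem mk_mem_poleBounded {p q : K[X]} {n : ℕ} :
    CoordinateRing.mk W (C p + C q * Y) ∈ poleBounded W n ↔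
      (p = 0 ∨ 2 * p.natDegree ≤ n) ∧ (q = 0 ∨ 2 * q.natDegree + 3 ≤ n) :=
  degree_norm_le_iff

theorem mul_mem_poleBounded {f g : W.CoordinateRing} {m n : ℕ} (hf : f ∈ poleBounded W m)
    (hg : g ∈ poleBounded W n) : f * g ∈ poleBounded W (m + n) := by
  rw [mem_poleBounded] at *
  rw [map_mul, degree_mul, Nat.cast_add]
  exact add_le_add hf hg

theorem pow_mem_poleBounded {f : W.CoordinateRing} {m : ℕ} (hf : f ∈ poleBounded W m) (n : ℕ) :
    f ^ n ∈ poleBounded W (n * m) := by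
  induction n with
  | zero =>
    rw [pow_zero, mem_poleBounded]
    simp
  | succ n ih =>
    rw [pow_succ, add_mul, one_mul]
    exact mul_mem_poleBounded ih hf

theorem XClass_mem_poleBounded (x : K) : XClass W x ∈ poleBounded W 2 := by
  rw [mem_poleBounded, norm_XClass, degree_pow, degree_X_sub_C]
  rfl

instance (n : ℕ) : FiniteDimensional K (poleBounded W n) := by
  let φ : (degreeLT K (n + 1) × degreeLT K (n + 1)) →ₗ[K] W.CoordinateRing :=
    { toFun := fun pq => CoordinateRing.mk W (C (pq.1 : K[X]) + C (pq.2 : K[X]) * Y)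
      map_add' := fun a b => by
        rw [← map_add]; congr 1
        simp only [Prod.fst_add, Prod.snd_add, Submodule.coe_add, C_add]; ring
      map_smul' := fun c a => by
        simp only [Prod.smul_fst, Prod.smul_snd, Submodule.coe_smul, RingHom.id_apply]
        have (f : W.CoordinateRing) : c • f = CoordinateRing.mk W (C (C c)) * f := by
          rw [Algebra.smul_def]; rfl
        rw [this, ← map_mul, smul_eq_C_mul, smul_eq_C_mul]; congr 1; simp only [C_mul]; ring }
  have hle : poleBounded W n ≤ LinearMap.range φ := by
    intro f hf
    obtain ⟨p, q, rfl⟩ := exists_mk_eq f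
    rw [mk_mem_poleBounded] at hf
    have hp : p ∈ degreeLT K (n + 1) := by
      rw [mem_degreeLT]
      rcases hf.1 with rfl | h
      · rw [degree_zero]; exact WithBot.bot_lt_coe _
      · exact degree_le_natDegree.trans_lt (by exact_mod_cast (by omega))
    have hq : q ∈ degreeLT K (n + 1) := by
      rw [mem_degreeLT]
      rcases hf.2 with rfl | h
      · rw [degree_zero]; exact WithBot.bot_lt_coe _
      · exact degree_le_natDegree.trans_lt (by exact_mod_cast (by omega))
    exact ⟨(⟨p, hp⟩, ⟨q, hq⟩), rfl⟩
  exact Submodule.finiteDimensional_of_le hle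

/-- Abscissas of zeros are roots of the norm, of degree at most `n`, and each lies under at most two
points. The sharp bound `n` is not needed. -/
theorem card_le_of_evalPoint_eq_zero {f : W.CoordinateRing} (hf : f ≠ 0) {n : ℕ}
    (hn : f ∈ poleBounded W n) (s : Finset W.Point) (hs : ∀ P ∈ s, P ≠ 0 ∧ evalPoint W f P = 0) :
    s.card ≤ 2 * n := by
  classical
  have hN := norm_ne_zero hf
  have h1 : s.image (fun P => P.xRep 0) ⊆ (Algebra.norm K[X] f).roots.toFinset := by
    intro x hx
    obtain ⟨P, hP, rfl⟩ := Finset.mem_image.mp hx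
    obtain ⟨hP0, hP1⟩ := hs P hP
    rcases P with _ | ⟨x, y, h⟩
    · exact absurd rfl hP0
    rw [Multiset.mem_toFinset, mem_roots hN, IsRoot.def]
    simp only [Point.xRep_some, Matrix.cons_val_zero]
    rw [eval_norm h.1, ← evalPoint_some f h, hP1, zero_mul]
  have h2 : (s.image (fun P => P.xRep 0)).card ≤ n := by
    refine (Finset.card_le_card h1).trans ((Multiset.toFinset_card_le _).trans ?_)
    refine (card_roots' _).trans ?_
    rw [mem_poleBounded, degree_eq_natDegree hN] at hn
    exact_mod_cast hn
  have h3 : s.card ≤ 2 * (s.image (fun P => P.xRep 0)).card := by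
    refine Finset.card_le_mul_card_image s 2 fun x hx => ?_
    obtain ⟨P, hP, rfl⟩ := Finset.mem_image.mp hx
    refine (Finset.card_le_card (t := {P, -P}) ?_).trans (Finset.card_le_two)
    intro Q hQ
    obtain ⟨hQ, hQx⟩ := Finset.mem_filter.mp hQ
    have hP0 := (hs P hP).1
    have hQ0 := (hs Q hQ).1
    rcases P with _ | ⟨x, y, h⟩
    · exact absurd rfl hP0
    rcases Q with _ | ⟨x', y', h'⟩
    · exact absurd rfl hQ0
    simpa using (Point.X_eq_iff (h₁ := h') (h₂ := h)).mp hQx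
  omega

/-- A root of the norm would give a zero of `f` at one of the points above it. So the norm has
degree 0, and the pole order bound leaves only constants. -/
theorem eq_const_of_evalPoint_ne_zero [IsAlgClosed K] [W.IsElliptic] {f : W.CoordinateRing}
    (h : ∀ P : W.Point, P ≠ 0 → evalPoint W f P ≠ 0) :
    ∃ c : K, c ≠ 0 ∧ ∀ P : W.Point, P ≠ 0 → evalPoint W f P = c := by
  classical
  have h0 : (Algebra.norm K[X] f).degree = 0 := by
    by_contra hd
    obtain ⟨x, hx⟩ := IsAlgClosed.exists_root _ hd
    obtain ⟨y, hxy⟩ := exists_nonsingular (W := W) x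
    rw [IsRoot.def, eval_norm hxy.1, mul_eq_zero] at hx
    rcases hx with hx | hx
    · exact h (.some x y hxy) (Point.some_ne_zero _) hx
    · exact h (.some x _ ((nonsingular_neg ..).mpr hxy)) (Point.some_ne_zero _) hx
  obtain ⟨p, q, rfl⟩ := exists_mk_eq f
  have h1 := (degree_norm_le_iff (n := 0)).mp h0.le
  have hq : q = 0 := h1.2.resolve_right (by omega)
  have hp : p.natDegree = 0 := by
    rcases h1.1 with rfl | h
    · simp
    · omega
  rw [natDegree_eq_zero] at hp
  obtain ⟨c, rfl⟩ := hp
  have h2 : ∀ P : W.Point, P ≠ 0 → evalPoint W (CoordinateRing.mk W (C (C c) + C q * Y)) P = c := by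
    intro P hP
    rcases P with _ | ⟨x, y, hxy⟩
    · exact absurd rfl hP
    · rw [evalPoint_some, evalEval_mk_C_add_C_mul_Y, hq]
      simp
  obtain ⟨y, hxy⟩ := exists_nonsingular (W := W) 0
  refine ⟨c, ?_, h2⟩
  rw [← h2 _ (Point.some_ne_zero hxy)]
  exact h _ (Point.some_ne_zero hxy)

instance [IsAlgClosed K] [W.IsElliptic] : Infinite W.Point := by
  have h := fun x : K => exists_nonsingular (W := W) x
  choose y hy using h
  refine Infinite.of_injective (fun x => Point.some x (y x) (hy x)) fun x x' h => ?_
  simp only [Point.some.injEq] at h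
  exact h.1

/-- The space of functions on points coming from regular functions with a pole of order at most `n`
at infinity. -/
noncomputable def poleBoundedFunctions (W : Affine K) (n : ℕ) : Submodule K (W.Point → K) :=
  (poleBounded W n).map (evalPoint W)

instance (n : ℕ) : FiniteDimensional K (poleBoundedFunctions W n) :=
  inferInstanceAs (FiniteDimensional K ((poleBounded W n).map (evalPoint W)))

theorem hasFinitelyManyZeros_poleBoundedFunctions (W : Affine K) (n : ℕ) :
    HasFinitelyManyZeros (poleBoundedFunctions W n) := by
  rintro ⟨s, f, hf, rfl⟩ hs
  have hf0 : f ≠ 0 := by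
    rintro rfl
    exact hs (Subtype.ext (map_zero _))
  rw [Filter.eventually_cofinite]
  have : {P : W.Point | P ≠ 0 ∧ evalPoint W f P = 0}.Finite := by
    by_contra hinf
    obtain ⟨t, ht, hc⟩ := Set.Infinite.exists_subset_card_eq hinf (2 * n + 1)
    have := card_le_of_evalPoint_eq_zero hf0 hf t (fun P hP => ht hP)
    omega
  refine (this.union (Set.finite_singleton 0)).subset fun P hP => ?_
  by_cases h : P = 0
  · exact .inr h
  · exact .inl ⟨h, by simpa using hP⟩

instance [IsAlgClosed K] [W.IsElliptic] (n : ℕ) : Nontrivial (poleBoundedFunctions W n) := by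
  have h1 : (1 : W.CoordinateRing) ∈ poleBounded W n := by
    rw [mem_poleBounded]
    simp
  refine ⟨⟨⟨_, 1, h1, rfl⟩, 0, fun h => ?_⟩⟩
  obtain ⟨y, hxy⟩ := exists_nonsingular (W := W) 0
  have h2 := congrFun (congrArg Subtype.val h) (.some _ _ hxy)
  simp at h2

theorem mem_poleBoundedFunctions {n : ℕ} {s : W.Point → K} :
    s ∈ poleBoundedFunctions W n ↔ s 0 = 0 ∧ ∃ p q : K[X], (p = 0 ∨ 2 * p.natDegree ≤ n) ∧
      (q = 0 ∨ 2 * q.natDegree + 3 ≤ n) ∧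
      ∀ (x y : K) (h : W.Nonsingular x y), s (.some x y h) = p.eval x + q.eval x * y := by
  constructor
  · rintro ⟨f, hf, rfl⟩
    obtain ⟨p, q, rfl⟩ := exists_mk_eq f
    obtain ⟨hp, hq⟩ := mk_mem_poleBounded.mp hf
    exact ⟨rfl, p, q, hp, hq, fun x y h => evalEval_mk_C_add_C_mul_Y h.1 p q⟩
  · rintro ⟨h0, p, q, hp, hq, h⟩
    refine ⟨_, mk_mem_poleBounded.mpr ⟨hp, hq⟩, ?_⟩
    ext P
    rcases P with _ | ⟨x, y, hxy⟩
    · exact h0.symm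
    · rw [h, evalPoint_some, evalEval_mk_C_add_C_mul_Y]

end RegularFunctions

/-! ### Negation and translation on the coordinate ring -/

section TranslationOperators

set_option linter.unusedSimpArgs false

open WeierstrassCurve WeierstrassCurve.Affine WeierstrassCurve.Affine.CoordinateRing Polynomial
open scoped Polynomial.Bivariate

variable {K : Type*} [Field K] {W : Affine K}

theorem eval₂_polynomial {S : Type*} [CommRing S] (i : K[X] →+* S) (r : S) :
    eval₂ i r W.polynomial = r ^ 2 + i (C W.a₁ * X + C W.a₃) * r -
      i (X ^ 3 + C W.a₂ * X ^ 2 + C W.a₄ * X + C W.a₆) := by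
  simp only [polynomial, eval₂_sub, eval₂_add, eval₂_mul, eval₂_pow, eval₂_X, eval₂_C]

theorem of_eq_mk_C (p : K[X]) :
    AdjoinRoot.of W.polynomial p = CoordinateRing.mk W (C p) := rfl

/-- The involution of the coordinate ring induced by negation on the curve. -/
noncomputable def conj (W : Affine K) : W.CoordinateRing →+* W.CoordinateRing :=
  AdjoinRoot.lift (AdjoinRoot.of W.polynomial) (CoordinateRing.mk W W.negPolynomial) (by
    rw [eval₂_polynomial, of_eq_mk_C, of_eq_mk_C, ← map_pow, ← map_mul, ← map_add, ← map_sub,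
      AdjoinRoot.mk_eq_zero]
    refine ⟨1, ?_⟩
    rw [negPolynomial, polynomial]
    ring1)

theorem conj_mk (p q : K[X]) : conj W (CoordinateRing.mk W (C p + C q * Y)) =
    CoordinateRing.mk W (C (p - q * (C W.a₁ * X + C W.a₃)) + C (-q) * Y) := by
  rw [conj, AdjoinRoot.lift_mk, eval₂_add, eval₂_mul, eval₂_X, eval₂_C, eval₂_C, of_eq_mk_C,
    of_eq_mk_C, ← map_mul, ← map_add, negPolynomial]
  refine congrArg (CoordinateRing.mk W) ?_
  simp only [C_sub, C_neg, C_mul]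
  ring1

theorem norm_conj (f : W.CoordinateRing) :
    Algebra.norm K[X] (conj W f) = Algebra.norm K[X] f := by
  obtain ⟨p, q, rfl⟩ := exists_mk_eq f
  rw [conj_mk, mk_eq_smul_basis, mk_eq_smul_basis, norm_smul_basis, norm_smul_basis]
  ring

theorem XClass_eq_mk (a : K) : XClass W a = CoordinateRing.mk W (C (X - C a) + C 0 * Y) := by
  rw [XClass]; simp

theorem YClass_eq_mk (b : K) :
    YClass W (C b) = CoordinateRing.mk W (C (-C b) + C 1 * Y) := by
  rw [YClass]
  refine congrArg (CoordinateRing.mk W) ?_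
  simp only [map_ofNat, C_0, C_1, C_neg, C_add, C_sub, C_mul, C_pow]
  ring

theorem conj_XClass (a : K) : conj W (XClass W a) = XClass W a := by
  rw [XClass_eq_mk, conj_mk]
  simp

theorem conj_YClass (a b : K) : conj W (YClass W (C b)) =
    -YClass W (C (W.negY a b)) - CoordinateRing.mk W (C (C W.a₁)) * XClass W a := by
  rw [YClass_eq_mk, conj_mk, YClass, XClass, ← map_neg (CoordinateRing.mk W),
    ← map_mul (CoordinateRing.mk W), ← map_sub (CoordinateRing.mk W), negY]
  refine congrArg (CoordinateRing.mk W) ?_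
  simp only [map_ofNat, C_0, C_1, C_neg, C_add, C_sub, C_mul, C_pow]
  ring

theorem map_conj_XYIdeal_le (a b : K) :
    (XYIdeal W a (C b)).map (conj W) ≤ XYIdeal W a (C (W.negY a b)) := by
  have h1 : XClass W a ∈ XYIdeal W a (C (W.negY a b)) :=
    Ideal.subset_span (Set.mem_insert _ _)
  have h2 : YClass W (C (W.negY a b)) ∈ XYIdeal W a (C (W.negY a b)) :=
    Ideal.subset_span (Set.mem_insert_of_mem _ rfl)
  rw [XYIdeal, Ideal.map_span, Ideal.span_le]
  rintro _ ⟨f, hf, rfl⟩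
  rcases hf with rfl | hf
  · rw [conj_XClass]
    exact h1
  · rw [Set.mem_singleton_iff] at hf
    rw [hf, conj_YClass a]
    exact sub_mem (neg_mem h2) (Ideal.mul_mem_left _ _ h1)

/-- A generator of the `n`-th power of the ideal of a point has a pole of order at least `n`. -/
theorem le_natDegree_norm_of_mem {a b : K} (h : W.Nonsingular a b) {n : ℕ} {f : W.CoordinateRing}
    (hf0 : f ≠ 0) (hf : f ∈ XYIdeal W a (C b) ^ n) : n ≤ (Algebra.norm K[X] f).natDegree := by
  have h1 : conj W f ∈ XYIdeal W a (C (W.negY a b)) ^ n := by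
    have := Ideal.mem_map_of_mem (conj W) hf
    rw [Ideal.map_pow] at this
    exact Ideal.pow_right_mono (map_conj_XYIdeal_le a b) n this
  -- The ideals of `(a, b)` and its negative multiply to `(x - a)`. Taking norms gives `(X - a)^{2n}
  -- ∣ N(f)²`.
  have h2 : conj W f * f ∈ Ideal.span {XClass W a ^ n} := by
    have := Ideal.mul_mem_mul h1 hf
    rwa [← mul_pow, XYIdeal_neg_mul h, XIdeal, Ideal.span_singleton_pow] at this
  obtain ⟨g, hg⟩ := Ideal.mem_span_singleton.mp h2
  have h3 := congrArg (Algebra.norm K[X]) hg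
  rw [map_mul, map_mul, map_pow, norm_conj, norm_XClass] at h3
  have hN := norm_ne_zero hf0
  have h4 : ((X - C a) ^ 2) ^ n ∣ Algebra.norm K[X] f * Algebra.norm K[X] f := ⟨_, h3⟩
  have h5 := natDegree_le_of_dvd h4 (mul_ne_zero hN hN)
  rw [natDegree_mul hN hN, ← pow_mul, natDegree_pow, natDegree_X_sub_C] at h5
  omega

/-- The numerator of the `x`-coordinate of translation by `(a, b)`. -/
noncomputable def translateX (W : Affine K) (a b : K) : W.CoordinateRing :=
  YClass W (C b) ^ 2 + CoordinateRing.mk W (C (C W.a₁)) * YClass W (C b) * XClass W a -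
    CoordinateRing.mk W (C (X + C (W.a₂ + a))) * XClass W a ^ 2

/-- The numerator of the `y`-coordinate of translation by `(a, b)`. -/
noncomputable def translateY (W : Affine K) (a b : K) : W.CoordinateRing :=
  -(YClass W (C b) * (translateX W a b - CoordinateRing.mk W (C (C a)) * XClass W a ^ 2)) -
    CoordinateRing.mk W (C (C b)) * XClass W a ^ 3 -
    CoordinateRing.mk W (C (C W.a₁)) * translateX W a b * XClass W a -
    CoordinateRing.mk W (C (C W.a₃)) * XClass W a ^ 3

theorem XClass_mem_XYIdeal (a b : K) : XClass W a ∈ XYIdeal W a (C b) :=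
  Ideal.subset_span (Set.mem_insert _ _)

theorem YClass_mem_XYIdeal (a b : K) : YClass W (C b) ∈ XYIdeal W a (C b) :=
  Ideal.subset_span (Set.mem_insert_of_mem _ rfl)

/-- The membership reflects that `(x - a)²` vanishes to order 2 at `P = (a, b)`, where `x(X + P)`
has no pole unless `2P = 0`. The formula gives it uniformly. -/
theorem translateX_mem_XYIdeal (a b : K) : translateX W a b ∈ XYIdeal W a (C b) ^ 2 := by
  have hx := XClass_mem_XYIdeal (W := W) a b
  have hy := YClass_mem_XYIdeal (W := W) a b
  refine sub_mem (add_mem (Ideal.pow_mem_pow hy 2) ?_)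
    (Ideal.mul_mem_left _ _ (Ideal.pow_mem_pow hx 2))
  rw [mul_assoc, pow_two]
  exact Ideal.mul_mem_left _ _ (Ideal.mul_mem_mul hy hx)

theorem translateY_mem_XYIdeal (a b : K) : translateY W a b ∈ XYIdeal W a (C b) ^ 3 := by
  have hx := XClass_mem_XYIdeal (W := W) a b
  have hy := YClass_mem_XYIdeal (W := W) a b
  have hX := translateX_mem_XYIdeal (W := W) a b
  have hx3 := Ideal.pow_mem_pow hx 3
  refine sub_mem (sub_mem (sub_mem (neg_mem ?_) (Ideal.mul_mem_left _ _ hx3)) ?_)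
    (Ideal.mul_mem_left _ _ hx3)
  · rw [pow_succ']
    exact Ideal.mul_mem_mul hy (sub_mem hX (Ideal.mul_mem_left _ _ (Ideal.pow_mem_pow hx 2)))
  · rw [mul_assoc, pow_succ]
    exact Ideal.mul_mem_left _ _ (Ideal.mul_mem_mul hX hx)

/-- The terms of pole order 6 and 5 cancel by the curve equation, as they must: translation takes
infinity to the finite point `(a, b)`, so only the pole of `(x - a)²` remains. -/
theorem translateX_mem_poleBounded {a b : K} : translateX W a b ∈ poleBounded W 4 := by
  have h : translateX W a b = CoordinateRing.mk W
      (C (C a * X ^ 2 + C (W.a₄ - W.a₁ * b + a ^ 2 + 2 * a * W.a₂) * X +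
        C (W.a₆ + b ^ 2 + W.a₁ * a * b - a ^ 2 * W.a₂ - a ^ 3)) +
      C (C (-(W.a₃ + 2 * b + W.a₁ * a))) * Y) := by
    rw [translateX, YClass, XClass]
    simp only [← map_mul, ← map_pow, ← map_add, ← map_sub]
    refine AdjoinRoot.mk_eq_mk.mpr ⟨1, ?_⟩
    rw [polynomial]
    simp only [map_ofNat, C_0, C_1, C_neg, C_add, C_sub, C_mul, C_pow]
    ring1
  rw [h, mk_mem_poleBounded]
  refine ⟨.inr ?_, .inr ?_⟩
  · have : (C a * X ^ 2 + C (W.a₄ - W.a₁ * b + a ^ 2 + 2 * a * W.a₂) * X +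
        C (W.a₆ + b ^ 2 + W.a₁ * a * b - a ^ 2 * W.a₂ - a ^ 3)).natDegree ≤ 2 := by compute_degree
    omega
  · rw [natDegree_C]
    omega

theorem translateY_mem_poleBounded {a b : K} : translateY W a b ∈ poleBounded W 6 := by
  set l1 := W.a₄ - W.a₁ * b + 3 * a ^ 2 + 2 * a * W.a₂ with hl1
  set l0 := W.a₆ + b ^ 2 + W.a₁ * a * b - a ^ 2 * W.a₂ - 2 * a ^ 3 with hl0
  set c := -(W.a₃ + 2 * b + W.a₁ * a) with hc
  have h : translateY W a b = CoordinateRing.mk W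
      (C (C b * (C l1 * X + C l0) - C c * (X ^ 3 + C W.a₂ * X ^ 2 + C W.a₄ * X + C W.a₆) -
          C b * (X - C a) ^ 3 - C W.a₁ * (C l1 * X + C l0 + C a * (X - C a) ^ 2) * (X - C a) -
          C W.a₃ * (X - C a) ^ 3) +
        C (-(C l1 * X + C l0) + C c * (C W.a₁ * X + C W.a₃) + C (c * b) -
          C (W.a₁ * c) * (X - C a)) * Y) := by
    rw [translateY, translateX, YClass, XClass]
    simp only [← map_mul, ← map_pow, ← map_add, ← map_sub, ← map_neg]
    refine AdjoinRoot.mk_eq_mk.mpr ⟨-(Y - C (C b)) - C (C W.a₁) * C (X - C a) - C (C c), ?_⟩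
    rw [polynomial, hl1, hl0, hc]
    simp only [map_ofNat, C_0, C_1, C_neg, C_add, C_sub, C_mul, C_pow]
    ring1
  rw [h, mk_mem_poleBounded]
  refine ⟨.inr ?_, .inr ?_⟩
  · have : (C b * (C l1 * X + C l0) - C c * (X ^ 3 + C W.a₂ * X ^ 2 + C W.a₄ * X + C W.a₆) -
          C b * (X - C a) ^ 3 - C W.a₁ * (C l1 * X + C l0 + C a * (X - C a) ^ 2) * (X - C a) -
          C W.a₃ * (X - C a) ^ 3).natDegree ≤ 3 := by compute_degree
    omega
  · have : (-(C l1 * X + C l0) + C c * (C W.a₁ * X + C W.a₃) + C (c * b) -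
          C (W.a₁ * c) * (X - C a)).natDegree ≤ 1 := by compute_degree
    omega

theorem evalAt_XClass {x y : K} (h : W.Equation x y) (a : K) : evalAt h (XClass W a) = x - a := by
  rw [XClass, evalAt_mk]; simp [evalEval]

theorem evalAt_YClass {x y : K} (h : W.Equation x y) (b : K) :
    evalAt h (YClass W (C b)) = y - b := by
  rw [YClass, evalAt_mk]; simp [evalEval]

theorem evalAt_mk_C {x y : K} (h : W.Equation x y) (p : K[X]) :
    evalAt h (CoordinateRing.mk W (C p)) = p.eval x := by
  rw [evalAt_mk]; simp [evalEval]

theorem evalAt_translateX [DecidableEq K] {x y a b : K} (h : W.Equation x y) (hx : x ≠ a) :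
    evalAt h (translateX W a b) = W.addX a x (W.slope a x b y) * (x - a) ^ 2 := by
  have hd : x - a ≠ 0 := sub_ne_zero.mpr hx
  have hs : W.slope a x b y = (y - b) / (x - a) := by
    rw [slope_of_X_ne hx.symm, ← neg_sub y b, ← neg_sub x a, neg_div_neg_eq]
  rw [translateX, hs, addX]
  simp only [map_sub, map_add, map_mul, map_pow, evalAt_XClass, evalAt_YClass, evalAt_mk_C, eval_C,
    eval_X]
  field_simp
  ring

theorem evalAt_translateY [DecidableEq K] {x y a b : K} (h : W.Equation x y) (hx : x ≠ a) :
    evalAt h (translateY W a b) = W.addY a x b (W.slope a x b y) * (x - a) ^ 3 := by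
  have hd : x - a ≠ 0 := sub_ne_zero.mpr hx
  have hs : W.slope a x b y = (y - b) / (x - a) := by
    rw [slope_of_X_ne hx.symm, ← neg_sub y b, ← neg_sub x a, neg_div_neg_eq]
  rw [translateY, addY, negAddY, negY]
  simp only [map_sub, map_neg, map_mul, map_pow, evalAt_translateX h hx, evalAt_XClass,
    evalAt_YClass, evalAt_mk_C, eval_C]
  generalize W.addX a x (W.slope a x b y) = x3
  rw [hs]
  field_simp
  ring

end TranslationOperators

/-! ### Translation by a torsion point preserves the pole bound -/

section TranslationOperators

open WeierstrassCurve WeierstrassCurve.Affine WeierstrassCurve.Affine.CoordinateRing Polynomial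
open scoped Polynomial.Bivariate

variable {K : Type*} [Field K] {W : Affine K}

/-- A generator of the `n`-th power of the ideal of `(a, b)` vanishes only there. -/
theorem evalAt_generator_ne_zero {a b : K} {n : ℕ} {f : W.CoordinateRing}
    (hf : XYIdeal W a (C b) ^ n = Ideal.span {f}) {x y : K} (hxy : W.Nonsingular x y)
    (hne : ¬(x = a ∧ y = b)) : evalAt hxy.1 f ≠ 0 := by
  intro h0
  have h1 := Ideal.pow_mem_pow (XClass_mem_XYIdeal (W := W) a b) n
  have h2 := Ideal.pow_mem_pow (YClass_mem_XYIdeal (W := W) a b) n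
  rw [hf] at h1 h2
  obtain ⟨g, hg⟩ := Ideal.mem_span_singleton.mp h1
  obtain ⟨k, hk⟩ := Ideal.mem_span_singleton.mp h2
  apply hne
  have h3 := congrArg (evalAt hxy.1) hg
  have h4 := congrArg (evalAt hxy.1) hk
  rw [map_pow, map_mul, h0, zero_mul, evalAt_XClass] at h3
  rw [map_pow, map_mul, h0, zero_mul, evalAt_YClass] at h4
  exact ⟨sub_eq_zero.mp (eq_zero_of_pow_eq_zero h3), sub_eq_zero.mp (eq_zero_of_pow_eq_zero h4)⟩

variable [DecidableEq K]

/-- Sending a point to the class of its ideal is a homomorphism to the class group, so `n P = 0`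
makes the `n`-th power of the ideal principal. -/
theorem exists_XYIdeal_pow_eq_span {a b : K} (h : W.Nonsingular a b) {n : ℕ}
    (hn : n • Point.some a b h = 0) :
    ∃ f : W.CoordinateRing, f ≠ 0 ∧ XYIdeal W a (C b) ^ n = Ideal.span {f} := by
  have h1 : ClassGroup.mk W.FunctionField (XYIdeal' (W := W) h ^ n) = 1 := by
    have h0 := congrArg Point.toClass hn
    rw [map_nsmul, map_zero] at h0
    have h1 := congrArg Additive.toMul h0
    rw [toMul_nsmul] at h1
    rw [map_pow]
    exact h1
  have h2 : ((XYIdeal' (W := W) h ^ n : (FractionalIdeal _ _)ˣ) :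
      FractionalIdeal (nonZeroDivisors W.CoordinateRing) W.FunctionField) =
      ((XYIdeal W a (C b) ^ n : Ideal W.CoordinateRing) : FractionalIdeal _ _) := by
    rw [Units.val_pow_eq_pow_val, XYIdeal'_eq, FractionalIdeal.coeIdeal_pow]
  obtain ⟨f, hf0, hf⟩ := (ClassGroup.mk_eq_one_of_coe_ideal h2).mp h1
  exact ⟨f, hf0, hf⟩

/-- The regular functions `f` for which `f(X + (a, b))` times the `n`-th power of `x - a` is a
regular function with the expected zeros and poles. -/
noncomputable def translatable {a b : K} (h : W.Nonsingular a b) (n : ℕ) :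
    Submodule K W.CoordinateRing where
  carrier := {f | ∃ N ∈ XYIdeal W a (C b) ^ n, N ∈ poleBounded W (2 * n) ∧
    ∀ (x y : K) (hxy : W.Nonsingular x y), x ≠ a →
      evalAt hxy.1 N = evalPoint W f (.some x y hxy + .some a b h) * (x - a) ^ n}
  zero_mem' := ⟨0, zero_mem _, zero_mem _, fun x y hxy _ => by simp⟩
  add_mem' := by
    rintro f g ⟨N, h1, h2, h3⟩ ⟨M, h4, h5, h6⟩
    exact ⟨N + M, add_mem h1 h4, add_mem h2 h5, fun x y hxy hx => by
      rw [map_add, map_add, h3 x y hxy hx, h6 x y hxy hx, Pi.add_apply, add_mul]⟩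
  smul_mem' := by
    rintro c f ⟨N, h1, h2, h3⟩
    refine ⟨c • N, ?_, Submodule.smul_mem _ _ h2, fun x y hxy hx => ?_⟩
    · rw [Algebra.smul_def]
      exact Ideal.mul_mem_left _ _ h1
    · rw [← evalPoint_some _ hxy, map_smul, Pi.smul_apply, smul_eq_mul, evalPoint_some, h3 x y hxy hx,
        map_smul, Pi.smul_apply, smul_eq_mul, mul_assoc]

theorem evalPoint_translate {a b : K} (h : W.Nonsingular a b) {x y : K} (hxy : W.Nonsingular x y)
    (hx : x ≠ a) (p q : K[X]) :
    evalPoint W (CoordinateRing.mk W (C p + C q * Y)) (.some x y hxy + .some a b h) =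
      p.eval (W.addX a x (W.slope a x b y)) +
        q.eval (W.addX a x (W.slope a x b y)) * W.addY a x b (W.slope a x b y) := by
  rw [add_comm (Point.some x y hxy), Point.add_of_X_ne hx.symm, evalPoint_some, evalEval_mk_C_add_C_mul_Y]

theorem X_pow_mem_translatable {a b : K} (h : W.Nonsingular a b) {n i : ℕ} (hi : 2 * i ≤ n) :
    CoordinateRing.mk W (C (X ^ i) + C 0 * Y) ∈ translatable h n := by
  refine ⟨translateX W a b ^ i * XClass W a ^ (n - 2 * i), ?_, ?_, fun x y hxy hx => ?_⟩
  · have h1 := Ideal.pow_mem_pow (translateX_mem_XYIdeal (W := W) a b) i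
    have h2 := Ideal.pow_mem_pow (XClass_mem_XYIdeal (W := W) a b) (n - 2 * i)
    have h3 := Ideal.mul_mem_mul h1 h2
    rwa [← pow_mul, ← pow_add, show 2 * i + (n - 2 * i) = n by omega] at h3
  · have h1 := pow_mem_poleBounded (translateX_mem_poleBounded (W := W) (a := a) (b := b)) i
    have h2 := pow_mem_poleBounded (XClass_mem_poleBounded (W := W) a) (n - 2 * i)
    have h3 := mul_mem_poleBounded h1 h2
    rwa [show i * 4 + (n - 2 * i) * 2 = 2 * n by omega] at h3
  · rw [evalPoint_translate h hxy hx, map_mul, map_pow, map_pow, evalAt_translateX hxy.1 hx,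
      evalAt_XClass, eval_pow, eval_X, eval_zero, zero_mul, add_zero, mul_pow, ← pow_mul, mul_assoc,
      ← pow_add, show 2 * i + (n - 2 * i) = n by omega]

theorem X_pow_mul_Y_mem_translatable {a b : K} (h : W.Nonsingular a b) {n i : ℕ}
    (hi : 2 * i + 3 ≤ n) : CoordinateRing.mk W (C 0 + C (X ^ i) * Y) ∈ translatable h n := by
  refine ⟨translateX W a b ^ i * translateY W a b * XClass W a ^ (n - (2 * i + 3)), ?_, ?_,
    fun x y hxy hx => ?_⟩
  · have h1 := Ideal.pow_mem_pow (translateX_mem_XYIdeal (W := W) a b) i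
    have h2 := Ideal.pow_mem_pow (XClass_mem_XYIdeal (W := W) a b) (n - (2 * i + 3))
    have h3 := Ideal.mul_mem_mul (Ideal.mul_mem_mul h1 (translateY_mem_XYIdeal (W := W) a b)) h2
    rwa [← pow_mul, ← pow_add, ← pow_add, show 2 * i + 3 + (n - (2 * i + 3)) = n by omega] at h3
  · have h1 := pow_mem_poleBounded (translateX_mem_poleBounded (W := W) (a := a) (b := b)) i
    have h2 := pow_mem_poleBounded (XClass_mem_poleBounded (W := W) a) (n - (2 * i + 3))
    have h3 := mul_mem_poleBounded
      (mul_mem_poleBounded h1 (translateY_mem_poleBounded (W := W) (a := a) (b := b))) h2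
    rwa [show i * 4 + 6 + (n - (2 * i + 3)) * 2 = 2 * n by omega] at h3
  · have h4 : (x - a) ^ n = (x - a) ^ (2 * i) * (x - a) ^ 3 * (x - a) ^ (n - (2 * i + 3)) := by
      rw [← pow_add, ← pow_add, show 2 * i + 3 + (n - (2 * i + 3)) = n by omega]
    rw [evalPoint_translate h hxy hx, map_mul, map_mul, map_pow, map_pow,
      evalAt_translateX hxy.1 hx, evalAt_translateY hxy.1 hx, evalAt_XClass, eval_pow, eval_X,
      eval_zero, zero_add, h4, mul_pow, ← pow_mul]
    ring

/-- By linearity it is enough to treat the monomials `x ^ i` and `x ^ i y`, whose translates have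
explicit numerators. -/
theorem poleBounded_le_translatable {a b : K} (h : W.Nonsingular a b) (n : ℕ) :
    poleBounded W n ≤ translatable h n := by
  intro f hf
  obtain ⟨p, q, rfl⟩ := exists_mk_eq f
  obtain ⟨hp, hq⟩ := mk_mem_poleBounded.mp hf
  have smul_mk : ∀ (c : K) (p q : K[X]), c • CoordinateRing.mk W (C p + C q * Y) =
      CoordinateRing.mk W (C (C c * p) + C (C c * q) * Y) := by
    intro c p q
    have : c • CoordinateRing.mk W (C p + C q * Y) =
        CoordinateRing.mk W (C (C c)) * CoordinateRing.mk W (C p + C q * Y) := by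
      rw [Algebra.smul_def]; rfl
    rw [this, ← map_mul]
    refine congrArg (CoordinateRing.mk W) ?_
    simp only [C_mul]
    ring
  have e : CoordinateRing.mk W (C p + C q * Y) =
      CoordinateRing.mk W (C p + C 0 * Y) + CoordinateRing.mk W (C 0 + C q * Y) := by
    rw [← map_add]
    refine congrArg (CoordinateRing.mk W) ?_
    simp
  rw [e]
  refine add_mem ?_ ?_
  · have : CoordinateRing.mk W (C p + C 0 * Y) = ∑ i ∈ Finset.range (p.natDegree + 1),
        p.coeff i • CoordinateRing.mk W (C (X ^ i) + C 0 * Y) := by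
      simp only [smul_mk, mul_zero]
      simp only [C_0, zero_mul, add_zero]
      rw [← map_sum (CoordinateRing.mk W), ← map_sum C, ← as_sum_range_C_mul_X_pow]
    rw [this]
    refine Submodule.sum_mem _ fun i hi => ?_
    have hi' := Finset.mem_range.mp hi
    rcases hp with rfl | hp
    · simp
    · exact Submodule.smul_mem _ _ (X_pow_mem_translatable h (by omega))
  · have : CoordinateRing.mk W (C 0 + C q * Y) = ∑ i ∈ Finset.range (q.natDegree + 1),
        q.coeff i • CoordinateRing.mk W (C 0 + C (X ^ i) * Y) := by
      simp only [smul_mk, mul_zero]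
      simp only [C_0, zero_add]
      rw [← map_sum (CoordinateRing.mk W), ← Finset.sum_mul, ← map_sum C,
        ← as_sum_range_C_mul_X_pow]
    rw [this]
    refine Submodule.sum_mem _ fun i hi => ?_
    have hi' := Finset.mem_range.mp hi
    rcases hq with rfl | hq
    · simp
    · exact Submodule.smul_mem _ _ (X_pow_mul_Y_mem_translatable h (by omega))

/-- For an `n`-torsion point `(a, b)`, translation by `(a, b)` followed by multiplication by
`(x - a) ^ n / f` preserves the functions with a pole of order at most `n` at infinity. -/
theorem exists_translate {a b : K} (h : W.Nonsingular a b) {n : ℕ} {f : W.CoordinateRing}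
    (hf0 : f ≠ 0) (hf : XYIdeal W a (C b) ^ n = Ideal.span {f}) {s : W.Point → K}
    (hs : s ∈ poleBoundedFunctions W n) :
    ∃ t ∈ poleBoundedFunctions W n, ∀ (x y : K) (hxy : W.Nonsingular x y), x ≠ a →
      evalAt hxy.1 f * t (.some x y hxy) = s (.some x y hxy + .some a b h) * (x - a) ^ n := by
  obtain ⟨g, hg, rfl⟩ := hs
  obtain ⟨N, hN1, hN2, hN3⟩ := poleBounded_le_translatable h n hg
  rw [hf] at hN1
  obtain ⟨t, rfl⟩ := Ideal.mem_span_singleton.mp hN1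
  refine ⟨_, ⟨t, ?_, rfl⟩, fun x y hxy hx => ?_⟩
  · have hfn : n ≤ (Algebra.norm K[X] f).natDegree :=
      le_natDegree_norm_of_mem h hf0 (hf ▸ Ideal.mem_span_singleton_self f)
    have hNf := norm_ne_zero hf0
    change (Algebra.norm K[X] t).degree ≤ n
    rw [mem_poleBounded, map_mul, degree_mul] at hN2
    by_cases ht : t = 0
    · have := (poleBounded W n).zero_mem
      rw [ht]
      exact this
    have hNt := norm_ne_zero ht
    rw [degree_eq_natDegree hNf, degree_eq_natDegree hNt] at hN2
    rw [degree_eq_natDegree hNt]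
    norm_cast at hN2 ⊢
    omega
  · rw [← hN3 x y hxy hx, map_mul, evalPoint_some]

end TranslationOperators

/-! ### From pointwise substitutions to linear operators -/

section ThetaOperators

open Filter

variable {K A : Type*} [Field K] {V : Submodule K (A → K)}

/-- A fibrewise weighted substitution preserving `V` up to finitely many points is a linear map. -/
theorem exists_end_of_forall_exists [Infinite A] (hV : HasFinitelyManyZeros V) (e : A → A)
    (h : A → K) (B : Set A) (hB : B.Finite)
    (hex : ∀ s ∈ V, ∃ t ∈ V, ∀ X ∉ B, t X = h X * s (e X)) :
    ∃ U : Module.End K V, ∀ s : V, ∀ X ∉ B, (U s : A → K) X = h X * (s : A → K) (e X) := by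
  have hex' : ∀ s : V, ∃ t : V, ∀ X ∉ B, (t : A → K) X = h X * (s : A → K) (e X) := by
    intro s
    obtain ⟨t, ht, h1⟩ := hex s s.2
    exact ⟨⟨t, ht⟩, h1⟩
  choose U hU using hex'
  have uniq : ∀ s t : V, (∀ X ∉ B, (s : A → K) X = (t : A → K) X) → s = t := by
    intro s t hst
    by_contra hne
    have h1 := hV (s - t) (sub_ne_zero.mpr hne)
    have h2 : ∀ᶠ X in cofinite, X ∉ B := by
      rw [eventually_cofinite]
      simpa using hB
    obtain ⟨X, h3, h4⟩ := (h1.and h2).exists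
    exact h3 (by simp [hst X h4])
  refine ⟨{ toFun := U, map_add' := ?_, map_smul' := ?_ }, hU⟩
  · intro s t
    refine uniq _ _ fun X hX => ?_
    simp [hU _ X hX, mul_add]
  · intro c s
    refine uniq _ _ fun X hX => ?_
    simp [hU _ X hX, mul_left_comm]

end ThetaOperators

/-! ### Theta operators of torsion points and zeros of their eigenvectors -/

section TranslationOperators

open WeierstrassCurve WeierstrassCurve.Affine WeierstrassCurve.Affine.CoordinateRing Polynomial
open scoped Polynomial.Bivariate

variable {K : Type*} [Field K] {W : Affine K}

theorem Point.X_ne_of_ne {x y a b : K} {h : W.Nonsingular x y} {h' : W.Nonsingular a b}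
    (h1 : Point.some x y h ≠ .some a b h') (h2 : Point.some x y h ≠ -.some a b h') : x ≠ a := by
  intro hx
  rcases (Point.X_eq_iff (h₁ := h) (h₂ := h')).mp hx with h3 | h3
  exacts [h1 h3, h2 h3]

theorem isThetaOperator_of_translation [DecidableEq K] {a b : K} (h : W.Nonsingular a b) {n : ℕ}
    {f : W.CoordinateRing} (hf : XYIdeal W a (C b) ^ n = Ideal.span {f})
    {U : Module.End K (poleBoundedFunctions W n)}
    (hU : ∀ (s : poleBoundedFunctions W n) (x y : K) (hxy : W.Nonsingular x y), x ≠ a →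
      evalAt hxy.1 f * (U s : W.Point → K) (.some x y hxy) =
        (s : W.Point → K) (.some x y hxy + .some a b h) * (x - a) ^ n) :
    IsThetaOperator (poleBoundedFunctions W n) (.some a b h) U := by
  refine ⟨fun X => evalPoint W (XClass W a ^ n) X / evalPoint W f X, ?_⟩
  rw [Filter.eventually_cofinite]
  refine Set.Finite.subset (s := {0, .some a b h, -.some a b h}) (by simp) fun X hX => ?_
  by_contra hX'
  simp only [Set.mem_insert_iff, Set.mem_singleton_iff, not_or] at hX'
  apply hX
  rcases X with _ | ⟨x, y, hxy⟩
  · exact absurd rfl hX'.1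
  have hx := Point.X_ne_of_ne hX'.2.1 hX'.2.2
  have hfx := evalAt_generator_ne_zero hf hxy (fun h => hx h.1)
  beta_reduce
  rw [evalPoint_some, evalPoint_some, map_pow, evalAt_XClass]
  refine ⟨div_ne_zero (pow_ne_zero n (sub_ne_zero.mpr hx)) hfx, fun s => ?_⟩
  have := hU s x y hxy hx
  field_simp
  linear_combination this

variable [IsAlgClosed K] [W.IsElliptic]

theorem eq_zero_of_eventually_evalPoint_eq_zero {f : W.CoordinateRing}
    (h : ∀ᶠ X in Filter.cofinite, evalPoint W f X = 0) : f = 0 := by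
  by_contra hf
  have hm : f ∈ poleBounded W (Algebra.norm K[X] f).natDegree := by
    rw [mem_poleBounded]
    exact degree_le_natDegree
  have h1 := hasFinitelyManyZeros_poleBoundedFunctions W _ ⟨_, f, hm, rfl⟩
  have h2 : (⟨_, f, hm, rfl⟩ : poleBoundedFunctions W _) = 0 := by
    by_contra h3
    obtain ⟨X, h4, h5⟩ := (h.and (h1 h3)).exists
    exact h5 h4
  obtain ⟨t, ht, hc⟩ := Set.Infinite.exists_subset_card_eq
    ((Set.finite_singleton (0 : W.Point)).infinite_compl)
    (2 * (Algebra.norm K[X] f).natDegree + 1)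
  have := card_le_of_evalPoint_eq_zero hf hm t
    (fun P hP => ⟨by simpa using ht hP, congrFun (congrArg Subtype.val h2) P⟩)
  omega

variable [DecidableEq K]

/-- The factor `(x - a) ^ n / f` has divisor `n(-P) - n(∞)`, which absorbs the pole of `s(X + P)` at
`-P`. The relation is kept at every point with `x ≠ a`, not just at almost all, so that individual
zeros can be transported. -/
theorem exists_translationOperator {a b : K} (h : W.Nonsingular a b) {n : ℕ}
    (hn : n • Point.some a b h = 0) :
    ∃ f : W.CoordinateRing, XYIdeal W a (C b) ^ n = Ideal.span {f} ∧
      ∃ U : Module.End K (poleBoundedFunctions W n), ∀ (s : poleBoundedFunctions W n) (x y : K)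
        (hxy : W.Nonsingular x y), x ≠ a → evalAt hxy.1 f * (U s : W.Point → K) (.some x y hxy) =
          (s : W.Point → K) (.some x y hxy + .some a b h) * (x - a) ^ n := by
  obtain ⟨f, hf0, hf⟩ := exists_XYIdeal_pow_eq_span h hn
  refine ⟨f, hf, ?_⟩
  have hB : ({0, .some a b h, -.some a b h} : Set W.Point).Finite := by simp
  obtain ⟨U, hU⟩ := exists_end_of_forall_exists (hasFinitelyManyZeros_poleBoundedFunctions W n)
    (fun X => X + .some a b h) (fun X => evalPoint W (XClass W a ^ n) X / evalPoint W f X) _ hB (by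
      intro s hs
      obtain ⟨t, ht, h1⟩ := exists_translate h hf0 hf hs
      refine ⟨t, ht, fun X hX => ?_⟩
      simp only [Set.mem_insert_iff, Set.mem_singleton_iff, not_or] at hX
      rcases X with _ | ⟨x, y, hxy⟩
      · exact absurd rfl hX.1
      have hx := Point.X_ne_of_ne hX.2.1 hX.2.2
      have hfx := evalAt_generator_ne_zero hf hxy (fun h => hx h.1)
      rw [evalPoint_some, evalPoint_some, map_pow, evalAt_XClass]
      have := h1 x y hxy hx
      field_simp
      linear_combination this)
  refine ⟨U, fun s x y hxy hx => ?_⟩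
  have hfx := evalAt_generator_ne_zero hf hxy (fun h => hx h.1)
  rw [hU s (.some x y hxy) (by
    simp only [Set.mem_insert_iff, Set.mem_singleton_iff, not_or, Point.neg_some,
      Point.some.injEq]
    exact ⟨Point.some_ne_zero _, fun h => hx h.1, fun h => hx h.1⟩)]
  rw [evalPoint_some, evalPoint_some, map_pow, evalAt_XClass]
  field_simp

theorem exists_isThetaOperator {n : ℕ} {P : W.Point} (hP : n • P = 0) :
    ∃ U, IsThetaOperator (poleBoundedFunctions W n) P U := by
  rcases P with _ | ⟨a, b, h⟩
  · exact ⟨1, .one⟩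
  · obtain ⟨f, hf, U, hU⟩ := exists_translationOperator h hP
    exact ⟨U, isThetaOperator_of_translation h hf hU⟩

/-- An eigenvector of a translation operator of odd order vanishes at some affine point. -/
theorem exists_zero_of_eigenvector {n : ℕ} (hodd : Odd n) {P : W.Point} (hP0 : P ≠ 0)
    (hP : n • P = 0) {s : poleBoundedFunctions W n}
    (hs : ∀ U, IsThetaOperator (poleBoundedFunctions W n) P U → ∃ c : K, c ≠ 0 ∧ U s = c • s) :
    ∃ Z : W.Point, Z ≠ 0 ∧ (s : W.Point → K) Z = 0 := by
  by_contra! hne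
  rcases P with _ | ⟨a, b, h⟩
  · exact hP0 rfl
  obtain ⟨f, hf, U, hU⟩ := exists_translationOperator h hP
  obtain ⟨c, hc, hUc⟩ := hs U (isThetaOperator_of_translation h hf hU)
  obtain ⟨_, g, hg, rfl⟩ := s
  obtain ⟨d, hd, hgd⟩ := eq_const_of_evalPoint_ne_zero hne
  -- A function without affine zeros is constant, so the eigenvector relation becomes `c f = (x - a)
  -- ^ n`. The right side vanishes at `-P`, while `f` vanishes only at `P`; and `P = -P` is excluded
  -- by odd order.
  have h1 : c • f - XClass W a ^ n = 0 := by
    apply eq_zero_of_eventually_evalPoint_eq_zero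
    rw [Filter.eventually_cofinite]
    refine Set.Finite.subset (s := {0, .some a b h, -.some a b h}) (by simp) fun X hX => ?_
    by_contra hX'
    simp only [Set.mem_insert_iff, Set.mem_singleton_iff, not_or] at hX'
    apply hX
    rcases X with _ | ⟨x, y, hxy⟩
    · exact absurd rfl hX'.1
    have hx := Point.X_ne_of_ne hX'.2.1 hX'.2.2
    have h2 := hU ⟨_, g, hg, rfl⟩ x y hxy hx
    have h3 : Point.some x y hxy + .some a b h ≠ 0 := by
      intro h0
      exact hX'.2.2 (eq_neg_of_add_eq_zero_left h0)
    rw [hUc] at h2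
    simp only [Submodule.coe_smul, Pi.smul_apply, smul_eq_mul, hgd _ h3,
      hgd _ (Point.some_ne_zero hxy)] at h2
    rw [map_sub, map_smul, Pi.sub_apply, Pi.smul_apply, evalPoint_some, evalPoint_some, map_pow,
      evalAt_XClass, smul_eq_mul, sub_eq_zero]
    refine mul_left_cancel₀ hd ?_
    linear_combination h2
  have hneg := (nonsingular_neg ..).mpr h
  have h2 := congrFun (congrArg (evalPoint W) h1) (.some _ _ hneg)
  rw [map_sub, map_smul, Pi.sub_apply, Pi.smul_apply, evalPoint_some, evalPoint_some, map_pow,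
    evalAt_XClass, sub_self, zero_pow hodd.pos.ne', sub_zero, smul_eq_mul, map_zero,
    Pi.zero_apply, mul_eq_zero, or_iff_right hc] at h2
  by_cases hb : W.negY a b = b
  · have h3 : 2 • Point.some a b h = 0 := by
      rw [two_nsmul]
      exact Point.add_self_of_Y_eq hb.symm
    obtain ⟨k, hk⟩ := hodd
    rw [hk, add_nsmul, mul_comm, mul_nsmul', h3, smul_zero, zero_add, one_nsmul] at hP
    exact hP0 hP
  · exact evalAt_generator_ne_zero hf hneg (fun h => hb h.2) h2

/-- A common eigenvector of the operators over a set of `n`-torsion points bounds the size of the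
set. -/
theorem card_le_of_common_eigenvector {n : ℕ} (hodd : Odd n) (t : Finset W.Point)
    (ht : ∀ P ∈ t, n • P = 0) {P₀ : W.Point} (hP₀ : P₀ ∈ t) (hP₀' : P₀ ≠ 0)
    {s : poleBoundedFunctions W n} (hs0 : s ≠ 0)
    (hs : ∀ P ∈ t, ∀ U, IsThetaOperator (poleBoundedFunctions W n) P U →
      ∃ c : K, c ≠ 0 ∧ U s = c • s) : t.card ≤ 2 * n + 2 := by
  obtain ⟨Z, hZ0, hZ⟩ := exists_zero_of_eigenvector hodd hP₀' (ht _ hP₀) (hs _ hP₀)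
  obtain ⟨_, g, hg, rfl⟩ := s
  have hg0 : g ≠ 0 := by
    rintro rfl
    exact hs0 (Subtype.ext (map_zero _))
  -- The relation carries the zero `Z` to `Z + P` unless `P = ±Z`. These two exceptions account for
  -- the `+ 2` in the bound.
  have key : ∀ P ∈ t \ {Z, -Z}, Z + P ≠ 0 ∧ evalPoint W g (Z + P) = 0 := by
    intro P hP
    simp only [Finset.mem_sdiff, Finset.mem_insert, Finset.mem_singleton, not_or] at hP
    refine ⟨fun h0 => hP.2.2 (eq_neg_of_add_eq_zero_right h0), ?_⟩
    rcases P with _ | ⟨a, b, h⟩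
    · rw [← Point.zero_def, add_zero]
      exact hZ
    obtain ⟨f, hf, U, hU⟩ := exists_translationOperator h (ht _ hP.1)
    obtain ⟨c, hc, hUc⟩ := hs _ hP.1 U (isThetaOperator_of_translation h hf hU)
    rcases Z with _ | ⟨x, y, hxy⟩
    · exact absurd rfl hZ0
    have hx : x ≠ a := Point.X_ne_of_ne (Ne.symm hP.2.1)
      (fun h => hP.2.2 (by rw [h, neg_neg]))
    have h2 := hU ⟨_, g, hg, rfl⟩ x y hxy hx
    rw [hUc] at h2
    simp only [Submodule.coe_smul, Pi.smul_apply, smul_eq_mul] at h2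
    simp only at hZ
    rw [hZ, mul_zero, mul_zero, eq_comm, mul_eq_zero] at h2
    exact h2.resolve_right (pow_ne_zero n (sub_ne_zero.mpr hx))
  have h1 := card_le_of_evalPoint_eq_zero hg0 hg ((t \ {Z, -Z}).image fun P => Z + P) (by
    intro Q hQ
    obtain ⟨P, hP, rfl⟩ := Finset.mem_image.mp hQ
    exact key P hP)
  rw [Finset.card_image_of_injective _ (add_right_injective Z)] at h1
  have h2 := Finset.le_card_sdiff {Z, -Z} t
  have h3 : ({Z, -Z} : Finset W.Point).card ≤ 2 := Finset.card_le_two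
  omega

end TranslationOperators

/-! ### The commutator pairing on torsion points -/

section ThetaPairing

open WeierstrassCurve WeierstrassCurve.Affine Polynomial

variable {K : Type*} [Field K] {W : Affine K} [DecidableEq K]

/-- The commutator pairing on the `n`-torsion points of a Weierstrass curve (the Weil pairing up to
normalisation). -/
noncomputable def thetaPairing (W : Affine K) (n : ℕ) (P Q : W.Point) : K :=
  Classical.epsilon (IsThetaCommutator (poleBoundedFunctions W n) P Q)

variable [IsAlgClosed K] [W.IsElliptic] {n : ℕ} {P P' Q Q' : W.Point}

theorem isThetaCommutator_thetaPairing (hP : n • P = 0) (hQ : n • Q = 0) :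
    IsThetaCommutator (poleBoundedFunctions W n) P Q (thetaPairing W n P Q) := by
  obtain ⟨S, hS⟩ := exists_isThetaOperator hP
  obtain ⟨T, hT⟩ := exists_isThetaOperator hQ
  exact Classical.epsilon_spec
    (exists_isThetaCommutator (hasFinitelyManyZeros_poleBoundedFunctions W n) hS hT)

theorem IsThetaCommutator.eq_thetaPairing (hP : n • P = 0) (hQ : n • Q = 0) {c : K}
    (hc : IsThetaCommutator (poleBoundedFunctions W n) P Q c) : c = thetaPairing W n P Q := by
  obtain ⟨S, hS⟩ := exists_isThetaOperator hP
  obtain ⟨T, hT⟩ := exists_isThetaOperator hQ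
  exact hc.eq_of_mul_eq (hasFinitelyManyZeros_poleBoundedFunctions W n) hS hT
    ((isThetaCommutator_thetaPairing hP hQ).2 S T hS hT)

theorem thetaPairing_self (hP : n • P = 0) : thetaPairing W n P P = 1 := by
  obtain ⟨S, hS⟩ := exists_isThetaOperator hP
  exact (isThetaCommutator_thetaPairing hP hP).self
    (hasFinitelyManyZeros_poleBoundedFunctions W n) hS

theorem thetaPairing_swap (hP : n • P = 0) (hQ : n • Q = 0) :
    thetaPairing W n Q P = (thetaPairing W n P Q)⁻¹ :=
  ((isThetaCommutator_thetaPairing hP hQ).symm.eq_thetaPairing hQ hP).symm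

theorem thetaPairing_add_left (hP : n • P = 0) (hP' : n • P' = 0) (hQ : n • Q = 0) :
    thetaPairing W n (P + P') Q = thetaPairing W n P Q * thetaPairing W n P' Q := by
  obtain ⟨S, hS⟩ := exists_isThetaOperator hP
  obtain ⟨S', hS'⟩ := exists_isThetaOperator hP'
  refine (IsThetaCommutator.eq_thetaPairing (by rw [smul_add, hP, hP', add_zero]) hQ ?_).symm
  exact (isThetaCommutator_thetaPairing hP hQ).add_left
    (hasFinitelyManyZeros_poleBoundedFunctions W n) hS hS' (isThetaCommutator_thetaPairing hP' hQ)

theorem thetaPairing_add_right (hP : n • P = 0) (hQ : n • Q = 0) (hQ' : n • Q' = 0) :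
    thetaPairing W n P (Q + Q') = thetaPairing W n P Q * thetaPairing W n P Q' := by
  rw [thetaPairing_swap (by rw [smul_add, hQ, hQ', add_zero]) hP, thetaPairing_add_left hQ hQ' hP,
    mul_inv, ← thetaPairing_swap hQ hP, ← thetaPairing_swap hQ' hP]

theorem nsmul_nsmul_eq_zero {A : Type*} [AddCommMonoid A] {n : ℕ} {P : A} (hP : n • P = 0) (k : ℕ) :
    n • k • P = 0 := by
  rw [smul_comm, hP, smul_zero]

theorem thetaPairing_zero_left (hQ : n • Q = 0) : thetaPairing W n 0 Q = 1 := by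
  have h := thetaPairing_add_left (smul_zero n) (smul_zero n) hQ
  rw [add_zero] at h
  exact (mul_eq_left₀ (isThetaCommutator_thetaPairing (smul_zero n) hQ).1).mp h.symm

theorem thetaPairing_nsmul_left (hP : n • P = 0) (hQ : n • Q = 0) (k : ℕ) :
    thetaPairing W n (k • P) Q = thetaPairing W n P Q ^ k := by
  induction k with
  | zero => rw [zero_smul, pow_zero, thetaPairing_zero_left hQ]
  | succ k ih =>
    rw [succ_nsmul, pow_succ, thetaPairing_add_left (nsmul_nsmul_eq_zero hP k) hP hQ, ih]

theorem thetaPairing_nsmul_right (hP : n • P = 0) (hQ : n • Q = 0) (k : ℕ) :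
    thetaPairing W n P (k • Q) = thetaPairing W n P Q ^ k := by
  rw [thetaPairing_swap (nsmul_nsmul_eq_zero hQ k) hP, thetaPairing_nsmul_left hQ hP,
    thetaPairing_swap hP hQ, inv_pow, inv_inv]

theorem thetaPairing_pow_eq_one (hP : n • P = 0) (hQ : n • Q = 0) :
    thetaPairing W n P Q ^ n = 1 := by
  rw [← thetaPairing_nsmul_left hP hQ, hP, thetaPairing_zero_left hQ]

/-- A trivial pairing makes the operators over `P` and `Q` commute. Their common eigenvector is then
one for every point generated by `P` and `Q`, and its zeros bound the number of such points. -/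
theorem card_le_of_thetaPairing_eq_one (hodd : Odd n) (hP : n • P = 0) (hQ : n • Q = 0)
    (hP0 : P ≠ 0) (h : thetaPairing W n P Q = 1) (t : Finset W.Point)
    (ht : ∀ R ∈ t, R ∈ AddSubmonoid.closure {P, Q}) : t.card ≤ 2 * n + 2 := by
  classical
  obtain ⟨S, hS⟩ := exists_isThetaOperator hP
  obtain ⟨T, hT⟩ := exists_isThetaOperator hQ
  have hc := isThetaCommutator_thetaPairing hP hQ
  rw [h] at hc
  obtain ⟨s, hs0, hs⟩ := hc.exists_common_eigenvector
    (hasFinitelyManyZeros_poleBoundedFunctions W n) hS hT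
  have hmem : P ∈ AddSubmonoid.closure {P, Q} := AddSubmonoid.subset_closure (by simp)
  have htor : ∀ R ∈ AddSubmonoid.closure {P, Q}, n • R = 0 := by
    intro R hR
    induction hR using AddSubmonoid.closure_induction with
    | mem x hx => rcases hx with rfl | rfl <;> assumption
    | zero => simp
    | add x y _ _ hx hy => rw [smul_add, hx, hy, add_zero]
  have hi : ∀ R ∈ insert P t, R ∈ AddSubmonoid.closure {P, Q} := by
    intro R hR
    rcases Finset.mem_insert.mp hR with rfl | hR
    exacts [hmem, ht R hR]
  exact (Finset.card_le_card (Finset.subset_insert P t)).trans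
    (card_le_of_common_eigenvector hodd (insert P t) (fun R hR => htor R (hi R hR))
      (Finset.mem_insert_self P t) hP0 hs0 fun R hR => hs R (hi R hR))

theorem AddSubgroup.mem_of_nsmul_mem_of_coprime {A : Type*} [AddCommGroup A] {H : AddSubgroup A}
    {Q : A} {a b : ℕ} (ha : a • Q ∈ H) (hb : b • Q ∈ H) (hab : a.Coprime b) : Q ∈ H := by
  have h : Q = a.gcdA b • a • Q + a.gcdB b • b • Q := by
    rw [← natCast_zsmul Q a, ← natCast_zsmul Q b, smul_smul, smul_smul, ← add_smul,
      mul_comm (a.gcdA b), mul_comm (a.gcdB b), ← Nat.gcd_eq_gcd_ab, hab.gcd_eq_one, Nat.cast_one,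
      one_smul]
  rw [h]
  exact H.add_mem (H.zsmul_mem ha _) (H.zsmul_mem hb _)

/-- Nondegeneracy: the points `i P + j Q` with `i < n`, `j < p` are distinct, and `n p ≤ 2n + 2`
fails because `n, p ≥ 3`. -/
theorem thetaPairing_ne_one {p : ℕ} (hp : p.Prime) (hp2 : p ≠ 2) (hodd : Odd n) (hpn : p ∣ n)
    (hP : addOrderOf P = n) (hQ : p • Q = 0) (hPQ : Q ∉ AddSubgroup.zmultiples P) :
    thetaPairing W n P Q ≠ 1 := by
  classical
  intro h
  have hnP : n • P = 0 := hP ▸ addOrderOf_nsmul_eq_zero P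
  have hnQ : n • Q = 0 := by
    obtain ⟨k, rfl⟩ := hpn
    rw [mul_nsmul, hQ, smul_zero]
  have hp3 : 3 ≤ p := by have := hp.two_le; omega
  have hn3 : 3 ≤ n := hp3.trans (Nat.le_of_dvd hodd.pos hpn)
  have hP0 : P ≠ 0 := by
    rintro rfl
    rw [addOrderOf_zero] at hP
    omega
  have hcop : ∀ {j j' : ℕ}, j < p → j' < p → j' < j → (j - j') • Q ∉ AddSubgroup.zmultiples P := by
    intro j j' hj hj' hlt hmem
    refine hPQ (AddSubgroup.mem_of_nsmul_mem_of_coprime hmem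
      (hQ ▸ AddSubgroup.zero_mem _ : p • Q ∈ AddSubgroup.zmultiples P) ?_)
    exact (Nat.coprime_of_lt_prime (by omega) (by omega) hp).symm
  have hdiff : ∀ {i i' j j' : ℕ}, j' < j → i • P + j • Q = i' • P + j' • Q →
      (j - j') • Q ∈ AddSubgroup.zmultiples P := by
    intro i i' j j' hlt he
    have : (j - j') • Q = i' • P - i • P := by
      obtain ⟨d, rfl⟩ := Nat.exists_eq_add_of_lt hlt
      rw [show j' + d + 1 - j' = d + 1 by omega]
      rw [add_assoc, add_smul] at he
      rw [eq_sub_iff_add_eq]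
      refine add_right_cancel (b := j' • Q) ?_
      rw [← he]
      abel
    rw [this]
    exact AddSubgroup.sub_mem _ (AddSubgroup.nsmul_mem_zmultiples P i')
      (AddSubgroup.nsmul_mem_zmultiples P i)
  have hinj : Set.InjOn (fun ij : ℕ × ℕ => ij.1 • P + ij.2 • Q)
      (Finset.range n ×ˢ Finset.range p : Finset (ℕ × ℕ)) := by
    rintro ⟨i, j⟩ h1 ⟨i', j'⟩ h2 he
    simp only [Finset.coe_product, Finset.coe_range, Set.mem_prod, Set.mem_Iio] at h1 h2 he
    have hj : j = j' := by
      rcases lt_trichotomy j j' with hlt | heq | hlt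
      · exact absurd (hdiff hlt he.symm) (hcop h2.2 h1.2 hlt)
      · exact heq
      · exact absurd (hdiff hlt he) (hcop h1.2 h2.2 hlt)
    subst hj
    rw [add_left_inj, nsmul_inj_mod, hP, Nat.mod_eq_of_lt h1.1, Nat.mod_eq_of_lt h2.1] at he
    rw [he]
  have h1 := card_le_of_thetaPairing_eq_one hodd hnP hnQ hP0 h
    ((Finset.range n ×ˢ Finset.range p).image fun ij : ℕ × ℕ => ij.1 • P + ij.2 • Q) (by
      intro R hR
      obtain ⟨ij, -, rfl⟩ := Finset.mem_image.mp hR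
      exact add_mem (nsmul_mem (AddSubmonoid.subset_closure (by simp)) _)
        (nsmul_mem (AddSubmonoid.subset_closure (by simp)) _))
  rw [Finset.card_image_of_injOn hinj, Finset.card_product, Finset.card_range,
    Finset.card_range] at h1
  nlinarith

end ThetaPairing

/-! ### Galois equivariance of the pairing -/

section Compatible

open WeierstrassCurve WeierstrassCurve.Affine Polynomial

variable {K : Type*} [Field K] {W : Affine K} [DecidableEq K]

/-- The automorphism `g` of the group of points acts on coordinates through `σ`. -/
def ActsOnCoordinates (σ : K ≃+* K) (g : AddAut W.Point) : Prop :=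
  ∀ (x y : K) (h : W.Nonsingular x y), ∃ h', g (.some x y h) = .some (σ x) (σ y) h'

variable {σ : K ≃+* K} {g : AddAut W.Point}

theorem ActsOnCoordinates.symm (h : ActsOnCoordinates σ g) :
    ActsOnCoordinates σ.symm g.symm := by
  intro x y hxy
  rcases hg : g.symm (.some x y hxy) with _ | ⟨a, b, hab⟩
  · exact absurd (g.symm.map_eq_zero_iff.mp hg) (Point.some_ne_zero hxy)
  · obtain ⟨h', h1⟩ := h a b hab
    rw [← hg] at h1
    erw [g.apply_symm_apply] at h1
    rw [Point.some.injEq] at h1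
    obtain ⟨rfl, rfl⟩ := h1
    simpa using hab

theorem ActsOnCoordinates.nsmul (h : ActsOnCoordinates σ g) (n : ℕ) :
    ActsOnCoordinates (σ ^ n) (n • g) := by
  induction n with
  | zero => exact fun x y hxy => ⟨hxy, by rw [zero_nsmul]; rfl⟩
  | succ n ih =>
    intro x y hxy
    obtain ⟨h1, h2⟩ := h x y hxy
    obtain ⟨h3, h4⟩ := ih _ _ h1
    exact ⟨h3, by rw [succ_nsmul, AddAut.add_apply, h2, h4]; rfl⟩

theorem ActsOnCoordinates.mem_poleBoundedFunctions (h : ActsOnCoordinates σ g) {n : ℕ}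
    {s : W.Point → K} (hs : s ∈ poleBoundedFunctions W n) :
    (fun X => σ.symm (s (g X))) ∈ poleBoundedFunctions W n := by
  rw [_root_.mem_poleBoundedFunctions] at hs ⊢
  obtain ⟨h0, p, q, hp, hq, h1⟩ := hs
  refine ⟨by simp [h0], p.map σ.symm.toRingHom, q.map σ.symm.toRingHom, ?_, ?_, ?_⟩
  · refine hp.imp (fun h => by rw [h, Polynomial.map_zero]) fun h => ?_
    exact (Nat.mul_le_mul_left 2 natDegree_map_le).trans h
  · refine hq.imp (fun h => by rw [h, Polynomial.map_zero]) fun h => ?_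
    exact (Nat.add_le_add_right (Nat.mul_le_mul_left 2 natDegree_map_le) 3).trans h
  · intro x y hxy
    obtain ⟨h', h2⟩ := h x y hxy
    rw [h2, h1]
    have hev : ∀ r : K[X], σ.symm (r.eval (σ x)) = (r.map σ.symm.toRingHom).eval x := by
      intro r
      have := (eval_map_apply (f := σ.symm.toRingHom) (p := r) (σ x)).symm
      simpa using this
    rw [map_add, map_mul, hev, hev, σ.symm_apply_apply]

theorem ActsOnCoordinates.thetaPairing_eq [IsAlgClosed K] [W.IsElliptic]
    (h : ActsOnCoordinates σ g) {n : ℕ} {P Q : W.Point}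
    (hP : n • P = 0) (hQ : n • Q = 0) :
    thetaPairing W n (g P) (g Q) = σ (thetaPairing W n P Q) := by
  obtain ⟨S, hS⟩ := exists_isThetaOperator hP
  obtain ⟨T, hT⟩ := exists_isThetaOperator hQ
  exact (isThetaCommutator_thetaPairing hP hQ).conj (hasFinitelyManyZeros_poleBoundedFunctions W n)
    σ g (fun s hs => h.symm.mem_poleBoundedFunctions hs) (fun s hs => h.mem_poleBoundedFunctions hs)
    hS hT (isThetaCommutator_thetaPairing (by rw [← map_nsmul, hP, map_zero])
      (by rw [← map_nsmul, hQ, map_zero]))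

end Compatible

/-! ### Orders of automorphisms acting on `p`-power torsion -/

section GroupAutomorphisms

variable {A : Type*} [AddCommGroup A] {p : ℕ}

theorem AddAut.nsmul_apply_eq_add {τ : AddAut A} {x : A} (h : τ (τ x - x) = τ x - x) (j : ℕ) :
    (j • τ) x = x + j • (τ x - x) := by
  induction j with
  | zero => rw [zero_nsmul, zero_nsmul, add_zero]; rfl
  | succ j ih =>
    rw [succ_nsmul', AddAut.add_apply, ih, map_add, map_nsmul, h, succ_nsmul]
    abel

/-- An automorphism acting trivially on the `p`-torsion has its `p ^ i`-th power acting trivially on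
the `p ^ (i + 1)`-torsion. -/
theorem AddAut.pow_nsmul_apply_eq {τ : AddAut A} (h : ∀ x : A, p • x = 0 → τ x = x) (i : ℕ) :
    ∀ x : A, p ^ (i + 1) • x = 0 → (p ^ i • τ) x = x := by
  induction i with
  | zero => simpa using h
  | succ i ih =>
    intro x hx
    have h1 : ∀ y : A, p • y = 0 → (p ^ i • τ) y = y := by
      intro y hy
      exact ih y (by rw [pow_succ, mul_comm, mul_nsmul, hy, smul_zero])
    have h2 : p • ((p ^ i • τ) x - x) = 0 := by
      rw [smul_sub, ← map_nsmul, ih (p • x) (by rw [smul_smul, ← pow_succ, hx]), sub_self]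
    rw [pow_succ, mul_nsmul, AddAut.nsmul_apply_eq_add (h1 _ h2), h2, add_zero]

/-- An endomorphism of the plane over `ZMod p` with non-square determinant has order dividing
`p ^ 2 - 1`. -/
theorem Module.End.pow_eq_self_of_not_isSquare {M : Type*} [AddCommGroup M] [Fact p.Prime]
    [Module (ZMod p) M] (hp2 : p ≠ 2) {P Q : M} (hPQ : ∀ R : M, ∃ a b : ZMod p, R = a • P + b • Q)
    {f : Module.End (ZMod p) M} {α β γ δ : ZMod p} (hP : f P = α • P + β • Q)
    (hQ : f Q = γ • P + δ • Q) (hsq : ¬ IsSquare (α * δ - β * γ)) : f ^ p ^ 2 = f := by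
  have hp : p.Prime := Fact.out
  have h2 : (2 : ZMod p) ≠ 0 := by
    intro h0
    have h1 : ((2 : ℕ) : ZMod p) = 0 := by exact_mod_cast h0
    rw [ZMod.natCast_eq_zero_iff] at h1
    exact hp2 ((Nat.prime_dvd_prime_iff_eq hp Nat.prime_two).mp h1)
  rcases subsingleton_or_nontrivial M with hM | hM
  · exact Subsingleton.elim _ _
  have : CharP (Module.End (ZMod p) M) p := charP_of_injective_algebraMap'  (ZMod p) p
  -- Cayley–Hamilton, checked on the spanning pair `P, Q`.
  have hf : f * f = (α + δ) • f - (α * δ - β * γ) • (1 : Module.End (ZMod p) M) := by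
    ext R
    obtain ⟨a, b, rfl⟩ := hPQ R
    simp only [Module.End.mul_apply, LinearMap.sub_apply, LinearMap.smul_apply, map_add, map_smul,
      hP, hQ, Module.End.one_apply]
    module
  set D := (α + δ) ^ 2 - 4 * (α * δ - β * γ) with hD
  -- A zero discriminant would make the determinant the square of half the trace.
  have hD0 : D ≠ 0 := by
    intro h0
    refine hsq ⟨(α + δ) / 2, ?_⟩
    field_simp
    linear_combination -(hD.symm.trans h0)
  -- Completing the square: `w² = D` is a nonzero scalar and `p² - 1` is an even multiple of `p -
  -- 1`, so `w ^ p² = w`. The `p²`-power map is additive on commuting elements and fixes scalars, so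
  -- `f ^ p² = f` follows.
  set w := 2 • f - algebraMap (ZMod p) (Module.End (ZMod p) M) (α + δ) with hw
  have hww : w ^ 2 = algebraMap (ZMod p) _ D := by
    rw [hw, hD, Algebra.algebraMap_eq_smul_one, Algebra.algebraMap_eq_smul_one, pow_two]
    simp only [sub_mul, mul_sub, smul_mul_assoc, mul_smul_comm, one_mul, mul_one, hf]
    module
  have hodd := hp.eq_two_or_odd'.resolve_left hp2
  obtain ⟨r, hr⟩ := hodd
  have hwp : w ^ p ^ 2 = w := by
    have he : p ^ 2 = 2 * ((p - 1) * (r + 1)) + 1 := by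
      rw [hr, Nat.add_sub_cancel]; ring
    rw [he, pow_succ, pow_mul, hww, ← map_pow, pow_mul, ZMod.pow_card_sub_one_eq_one hD0, one_pow,
      map_one, one_mul]
  have hcomm : Commute (2 • f) (algebraMap (ZMod p) (Module.End (ZMod p) M) (α + δ)) :=
    (Algebra.commutes (α + δ) (2 • f)).symm
  have h3 : w ^ p ^ 2 = (2 • f) ^ p ^ 2 -
      algebraMap (ZMod p) (Module.End (ZMod p) M) (α + δ) ^ p ^ 2 := by
    rw [hw, sub_pow_char_pow_of_commute _ _ hcomm]
  have hfix : ∀ c : ZMod p, c ^ p ^ 2 = c := fun c => by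
    rw [pow_two, pow_mul, ZMod.pow_card, ZMod.pow_card]
  rw [hwp, ← map_pow, hfix, hw, sub_left_inj, ← Nat.cast_smul_eq_nsmul (ZMod p), smul_pow,
    hfix] at h3
  exact (smul_right_injective _ (by exact_mod_cast h2) h3).symm

theorem AddMonoid.End.pow_eq_self_of_not_isSquare {M : Type*} [AddCommGroup M] [Fact p.Prime]
    [Module (ZMod p) M] (hp2 : p ≠ 2) {P Q : M}
    (hPQ : ∀ R : M, ∃ a b : ℕ, R = a • P + b • Q) {g : AddMonoid.End M} {α β γ δ : ℕ}
    (hgP : g P = α • P + β • Q) (hgQ : g Q = γ • P + δ • Q)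
    (hsq : ¬ IsSquare (α * δ - β * γ : ZMod p)) : g ^ p ^ 2 = g := by
  let f : Module.End (ZMod p) M := AddMonoidHom.toZModLinearMap p g
  have hf : ∀ R, f R = g R := fun R => rfl
  have hfj : ∀ (j : ℕ) (R : M), (f ^ j) R = (g ^ j) R := by
    intro j
    induction j with
    | zero => intro R; rfl
    | succ j ih => intro R; rw [pow_succ, Module.End.mul_apply, ih, hf, pow_succ]; rfl
  have hcast : ∀ (k : ℕ) (R : M), (k : ZMod p) • R = k • R :=
    fun k R => Nat.cast_smul_eq_nsmul (ZMod p) k R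
  have h := Module.End.pow_eq_self_of_not_isSquare hp2 (P := P) (Q := Q) (f := f) (α := α) (β := β)
    (γ := γ) (δ := δ) (fun R => by
      obtain ⟨a, b, rfl⟩ := hPQ R
      exact ⟨a, b, by rw [hcast, hcast]⟩)
    (by rw [hf, hcast, hcast]; exact hgP) (by rw [hf, hcast, hcast]; exact hgQ) hsq
  ext R
  rw [← hfj, h, hf]

theorem AddAut.nsmul_apply_eq_of_not_isSquare [Fact p.Prime] (hp2 : p ≠ 2) {g : AddAut A} {P Q : A}
    (hP : p • P = 0) (hQ : p • Q = 0)
    (hPQ : ∀ R : A, p • R = 0 → ∃ a b : ℕ, R = a • P + b • Q) {α β γ δ : ℕ}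
    (hgP : g P = α • P + β • Q) (hgQ : g Q = γ • P + δ • Q)
    (hsq : ¬ IsSquare (α * δ - β * γ : ZMod p)) {R : A} (hR : p • R = 0) :
    ((p ^ 2 - 1) • g) R = R := by
  let f : AddMonoid.End (nsmulAddMonoidHom (α := A) p).ker :=
    ((g : A →+ A).comp (AddSubgroup.subtype _)).codRestrict (nsmulAddMonoidHom (α := A) p).ker
      fun R => by
        have : p • g R = 0 := by rw [← map_nsmul]; exact (congrArg g R.2).trans (map_zero g)
        exact this
  have hf : ∀ R : (nsmulAddMonoidHom (α := A) p).ker, (f R : A) = g R := fun R => rfl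
  have hfj : ∀ (j : ℕ) (R : (nsmulAddMonoidHom (α := A) p).ker),
      ((f ^ j) R : A) = (j • g) R := by
    intro j
    induction j with
    | zero => intro R; rw [zero_nsmul, pow_zero]; rfl
    | succ j ih =>
      intro R
      rw [pow_succ, AddMonoid.End.coe_mul, Function.comp_apply, ih, hf, succ_nsmul]
      rfl
  let _ : Module (ZMod p) (nsmulAddMonoidHom (α := A) p).ker :=
    AddCommGroup.zmodModule fun R => Subtype.ext R.2
  have hpow2 := AddMonoid.End.pow_eq_self_of_not_isSquare hp2
    (P := (⟨P, hP⟩ : (nsmulAddMonoidHom (α := A) p).ker)) (Q := ⟨Q, hQ⟩) (g := f)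
    (fun ⟨R, hR⟩ => by
      obtain ⟨a, b, rfl⟩ := hPQ R hR
      exact ⟨a, b, rfl⟩)
    (Subtype.ext hgP) (Subtype.ext hgQ) hsq
  have h3 := hfj (p ^ 2) ⟨R, hR⟩
  rw [hpow2, hf] at h3
  have h4 : p ^ 2 = 1 + (p ^ 2 - 1) :=
    (Nat.add_sub_cancel' (pow_pos (Fact.out : p.Prime).pos 2)).symm
  rw [h4, add_nsmul, one_nsmul] at h3
  exact (g.injective h3).symm

end GroupAutomorphisms

/-! ### Action on torsion points against action on roots of unity -/

section TorsionAutomorphisms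

open WeierstrassCurve WeierstrassCurve.Affine Polynomial

variable {K : Type*} [Field K] [IsAlgClosed K] {W : Affine K} [DecidableEq K] [W.IsElliptic]
  {p : ℕ}

theorem mem_zmultiples_of_thetaPairing_eq_one (hp : p.Prime) (hp2 : p ≠ 2) {P Q : W.Point}
    (hP : addOrderOf P = p) (hQ : p • Q = 0) (h : thetaPairing W p P Q = 1) :
    Q ∈ AddSubgroup.zmultiples P := by
  by_contra hPQ
  exact thetaPairing_ne_one hp hp2 (hp.odd_of_ne_two hp2) dvd_rfl hP hQ hPQ h

/-- The pairing of `P` and `Q` is a primitive `p`-th root of unity, so for some `b` the point `R - b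
Q` pairs trivially with `P` and is a multiple of it. No upper bound on the number of `p`-torsion
points is required. -/
theorem exists_eq_add_of_thetaPairing_ne_one (hp : p.Prime) (hp2 : p ≠ 2) {P Q R : W.Point}
    (hP : addOrderOf P = p) (hQ : p • Q = 0) (h : thetaPairing W p P Q ≠ 1) (hR : p • R = 0) :
    ∃ a b : ℕ, R = a • P + b • Q := by
  have hP' : p • P = 0 := hP ▸ addOrderOf_nsmul_eq_zero P
  have := Fact.mk hp
  have := NeZero.mk hp.ne_zero
  have hω : IsPrimitiveRoot (thetaPairing W p P Q) p := by
    exact IsPrimitiveRoot.iff_orderOf.mpr (orderOf_eq_prime (thetaPairing_pow_eq_one hP' hQ) h)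
  obtain ⟨b, -, hb⟩ := hω.eq_pow_of_pow_eq_one (thetaPairing_pow_eq_one hP' hR)
  -- The coefficient `(p - 1) * b` plays the role of `-b` among natural numbers.
  have h1 : p • (R + ((p - 1) * b) • Q) = 0 := by
    rw [smul_add, hR, nsmul_nsmul_eq_zero hQ, add_zero]
  have h2 := mem_zmultiples_of_thetaPairing_eq_one hp hp2 hP h1 (by
    rw [thetaPairing_add_right hP' hR (nsmul_nsmul_eq_zero hQ _), thetaPairing_nsmul_right hP' hQ,
      ← hb, ← pow_add, show b + (p - 1) * b = p * b by
        obtain ⟨q, rfl⟩ := Nat.exists_eq_succ_of_ne_zero hp.ne_zero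
        rw [Nat.succ_sub_one, Nat.succ_eq_add_one]; ring, pow_mul, hω.pow_eq_one, one_pow])
  rw [(addOrderOf_pos_iff.mp (hP ▸ hp.pos)).mem_zmultiples_iff_mem_range_addOrderOf] at h2
  obtain ⟨a, -, ha⟩ := Finset.mem_image.mp h2
  refine ⟨a, b, ?_⟩
  have h3 : R + ((p - 1) * b) • Q + b • Q = R := by
    rw [add_assoc, ← add_smul, show (p - 1) * b + b = b * p by
      obtain ⟨q, rfl⟩ := Nat.exists_eq_succ_of_ne_zero hp.ne_zero
      rw [Nat.succ_sub_one, Nat.succ_eq_add_one]; ring, mul_nsmul', hQ, smul_zero, add_zero]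
  rw [ha, h3]

variable [CharZero K]

theorem Point.exists_addOrderOf_eq_prime (W : Affine K) [W.IsElliptic] (hp : p.Prime) :
    ∃ P : W.Point, addOrderOf P = p := by
  obtain ⟨s, hs, ht⟩ := Point.exists_torsion_finset (W := W) hp.ne_zero
  obtain ⟨P, hP, hP0⟩ : ∃ P ∈ s, P ≠ 0 := by
    apply Finset.exists_mem_ne
    rw [hs]
    nlinarith [hp.two_le]
  have := Fact.mk hp
  exact ⟨P, addOrderOf_eq_prime (ht P hP) hP0⟩

theorem Point.exists_nsmul_eq_zero_notMem_zmultiples (hp : p.Prime) {P : W.Point}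
    (hP : addOrderOf P = p) : ∃ Q : W.Point, p • Q = 0 ∧ Q ∉ AddSubgroup.zmultiples P := by
  classical
  obtain ⟨s, hs, ht⟩ := Point.exists_torsion_finset (W := W) hp.ne_zero
  by_contra! h
  have hsub : s ⊆ (Finset.range p).image fun i => i • P := by
    intro Q hQ
    have h1 := h Q (ht Q hQ)
    rw [(addOrderOf_pos_iff.mp (hP ▸ hp.pos)).mem_zmultiples_iff_mem_range_addOrderOf, hP] at h1
    exact h1
  have h1 := (Finset.card_le_card hsub).trans Finset.card_image_le
  rw [hs, Finset.card_range] at h1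
  nlinarith [hp.two_le]

/-- If `g` acts on coordinates through `σ` and trivially on the `p ^ m`-torsion, then `σ` fixes the
`p ^ m`-th roots of unity. -/
theorem ActsOnCoordinates.apply_eq_of_pow_eq_one (hp : p.Prime) (hp2 : p ≠ 2) {σ : K ≃+* K}
    {g : AddAut W.Point} (hg : ActsOnCoordinates σ g) {m : ℕ}
    (htriv : ∀ R : W.Point, p ^ (m + 1) • R = 0 → g R = R) {ξ : K} (hξ : ξ ^ p ^ (m + 1) = 1) :
    σ ξ = ξ := by
  have hfact := Fact.mk hp
  obtain ⟨P₀, hP₀⟩ := Point.exists_addOrderOf_eq_prime W hp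
  obtain ⟨Q₀, hQ₀, hPQ⟩ := Point.exists_nsmul_eq_zero_notMem_zmultiples hp hP₀
  have hpm : p ^ m ≠ 0 := pow_ne_zero m hp.ne_zero
  obtain ⟨P, hP⟩ := Point.exists_nsmul_eq hpm P₀
  obtain ⟨Q, hQ⟩ := Point.exists_nsmul_eq hpm Q₀
  have hpP₀ : p • P₀ = 0 := hP₀ ▸ addOrderOf_nsmul_eq_zero P₀
  have hnP : p ^ (m + 1) • P = 0 := by rw [pow_succ, mul_nsmul, hP, hpP₀]
  have hnQ : p ^ (m + 1) • Q = 0 := by rw [pow_succ, mul_nsmul, hQ, hQ₀]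
  have hoP : addOrderOf P = p ^ (m + 1) := by
    refine addOrderOf_eq_prime_pow (fun h => ?_) hnP
    rw [hP] at h
    rw [h, addOrderOf_zero] at hP₀
    exact hp.one_lt.ne hP₀
  have hPQ' : Q₀ ∉ AddSubgroup.zmultiples P := by
    intro hmem
    rw [(addOrderOf_pos_iff.mp (hoP ▸ pow_pos hp.pos _)).mem_zmultiples_iff_mem_range_addOrderOf] at hmem
    obtain ⟨i, -, hi⟩ := Finset.mem_image.mp hmem
    have h1 : (i * p) • P = 0 := by rw [mul_nsmul, hi, hQ₀]
    rw [← addOrderOf_dvd_iff_nsmul_eq_zero, hoP, pow_succ] at h1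
    obtain ⟨j, rfl⟩ := Nat.dvd_of_mul_dvd_mul_right hp.pos h1
    rw [mul_nsmul, hP] at hi
    exact hPQ (hi ▸ AddSubgroup.nsmul_mem_zmultiples P₀ j)
  have hodd : Odd (p ^ (m + 1)) := (hp.odd_of_ne_two hp2).pow
  -- The pairing of `P` with `Q₀ = p ^ m Q` is the `p ^ m`-th power of that of `P` and `Q`. Being
  -- nontrivial, it makes the latter a primitive `p ^ (m + 1)`-th root of unity.
  have hne := thetaPairing_ne_one hp hp2 hodd (dvd_pow_self p m.succ_ne_zero) hoP hQ₀ hPQ'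
  rw [← hQ, thetaPairing_nsmul_right hnP hnQ] at hne
  have hω : IsPrimitiveRoot (thetaPairing W (p ^ (m + 1)) P Q) (p ^ (m + 1)) := by
    exact IsPrimitiveRoot.iff_orderOf.mpr
      (orderOf_eq_prime_pow hne (thetaPairing_pow_eq_one hnP hnQ))
  have := NeZero.mk (pow_ne_zero (m + 1) hp.ne_zero)
  obtain ⟨i, -, rfl⟩ := hω.eq_pow_of_pow_eq_one hξ
  rw [map_pow, ← hg.thetaPairing_eq hnP hnQ, htriv P hnP, htriv Q hnQ]

/-- If `σ` raises the `p`-th roots of unity to a power that is a non-square modulo `p`, then its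
`(p ^ 2 - 1)`-th power acts trivially on the `p`-torsion. -/
theorem ActsOnCoordinates.nsmul_apply_eq (hp : p.Prime) (hp2 : p ≠ 2) {σ : K ≃+* K}
    {g : AddAut W.Point} (hg : ActsOnCoordinates σ g) {d : ℕ}
    (hσ : ∀ ξ : K, ξ ^ p = 1 → σ ξ = ξ ^ d) (hd : ¬ IsSquare (d : ZMod p)) {R : W.Point}
    (hR : p • R = 0) : ((p ^ 2 - 1) • g) R = R := by
  have hfact := Fact.mk hp
  have := NeZero.mk hp.ne_zero
  obtain ⟨P, hoP⟩ := Point.exists_addOrderOf_eq_prime W hp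
  obtain ⟨Q, hQ, hPQ⟩ := Point.exists_nsmul_eq_zero_notMem_zmultiples hp hoP
  have hP : p • P = 0 := hoP ▸ addOrderOf_nsmul_eq_zero P
  have hne := thetaPairing_ne_one hp hp2 (hp.odd_of_ne_two hp2) dvd_rfl hoP hQ hPQ
  have hg0 : ∀ {R : W.Point}, p • R = 0 → p • g R = 0 := fun h => by
    rw [← map_nsmul, h, map_zero]
  obtain ⟨α, β, hgP⟩ := exists_eq_add_of_thetaPairing_ne_one hp hp2 hoP hQ hne (hg0 hP)
  obtain ⟨γ, δ, hgQ⟩ := exists_eq_add_of_thetaPairing_ne_one hp hp2 hoP hQ hne (hg0 hQ)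
  have hpow := thetaPairing_pow_eq_one hP hQ
  have h0 := (isThetaCommutator_thetaPairing hP hQ).1
  -- Expanding the pairing of `g P` and `g Q` bilinearly gives the pairing of `P` and `Q` to the
  -- power `α δ - β γ`; equivariance gives the power `d`.
  have hdet : (α * δ - β * γ : ZMod p) = d := by
    have h1 := hg.thetaPairing_eq hP hQ
    rw [hσ _ hpow, hgP, hgQ] at h1
    have hz := fun k => nsmul_nsmul_eq_zero hP k
    have hz' := fun k => nsmul_nsmul_eq_zero hQ k
    rw [thetaPairing_add_left (hz α) (hz' β) (by rw [smul_add, hz, hz', add_zero]),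
      thetaPairing_add_right (hz α) (hz γ) (hz' δ), thetaPairing_add_right (hz' β) (hz γ) (hz' δ),
      thetaPairing_nsmul_left hP (hz γ), thetaPairing_nsmul_left hP (hz' δ),
      thetaPairing_nsmul_left hQ (hz γ), thetaPairing_nsmul_left hQ (hz' δ),
      thetaPairing_nsmul_right hP hP, thetaPairing_nsmul_right hP hQ,
      thetaPairing_nsmul_right hQ hP, thetaPairing_nsmul_right hQ hQ, thetaPairing_self hP,
      thetaPairing_self hQ, thetaPairing_swap hP hQ] at h1
    simp only [one_pow, one_mul, mul_one, inv_pow, ← pow_mul] at h1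
    rw [mul_inv_eq_iff_eq_mul₀ (pow_ne_zero _ h0), ← pow_add] at h1
    have h2 := (isOfFinOrder_iff_pow_eq_one.mpr ⟨p, hp.pos, hpow⟩).pow_eq_pow_iff_modEq.mp h1
    rw [orderOf_eq_prime hpow hne, ← ZMod.natCast_eq_natCast_iff] at h2
    push_cast at h2
    linear_combination h2
  exact AddAut.nsmul_apply_eq_of_not_isSquare hp2 hP hQ
    (fun R hR => exists_eq_add_of_thetaPairing_ne_one hp hp2 hoP hQ hne hR) hgP hgQ
    (by rwa [hdet]) hR

end TorsionAutomorphisms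

/-! ### Primitive roots modulo `p²` and lifting the exponent -/

section PrimitiveRootModuloSquare

variable {p : ℕ}

/-- A generator of `(ℤ/p²)ˣ` has order `p(p - 1)`, which does not divide `(p + 1)(p - 1)`. Were it a
square mod `p`, its power `(p - 1)/2` would be 1 mod `p`, hence its power `p(p - 1)/2` would be 1
mod `p²`, against its order. -/
theorem exists_not_isSquare_and_not_modEq (hp : p.Prime) (hp2 : p ≠ 2) :
    ∃ g : ℕ, g.Coprime p ∧ ¬ IsSquare (g : ZMod p) ∧ ¬ g ^ (p ^ 2 - 1) ≡ 1 [MOD p ^ 2] := by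
  have hfact := Fact.mk hp
  have := ZMod.isCyclic_units_of_prime_pow p hp hp2 2
  have hp3 : 3 ≤ p := by have := hp.two_le; omega
  obtain ⟨u, hu⟩ := IsCyclic.exists_generator (α := (ZMod (p ^ 2))ˣ)
  have hord : orderOf u = p * (p - 1) := by
    rw [orderOf_eq_card_of_forall_mem_zpowers hu, Nat.card_eq_fintype_card,
      ZMod.card_units_eq_totient, Nat.totient_prime_pow hp two_pos, show 2 - 1 = 1 from rfl, pow_one]
  have hcop : (u : ZMod (p ^ 2)).val.Coprime p :=
    Nat.Coprime.coprime_dvd_right (dvd_pow_self p two_ne_zero) (ZMod.val_coe_unit_coprime u)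
  have hdvd : ∀ m : ℕ, (u : ZMod (p ^ 2)).val ^ m ≡ 1 [MOD p ^ 2] → p * (p - 1) ∣ m := by
    intro m hm
    rw [← ZMod.natCast_eq_natCast_iff, Nat.cast_pow, ZMod.natCast_zmod_val, Nat.cast_one] at hm
    rw [← hord, orderOf_dvd_iff_pow_eq_one]
    exact Units.ext (by simpa using hm)
  refine ⟨_, hcop, fun hsq => ?_, fun h => ?_⟩
  · have h0 : ((u : ZMod (p ^ 2)).val : ZMod p) ≠ 0 := by
      rw [Ne, ZMod.natCast_eq_zero_iff]
      exact fun h => hp.one_lt.ne' (hcop.symm.eq_one_of_dvd h)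
    rw [ZMod.euler_criterion p h0] at hsq
    have h1 : (u : ZMod (p ^ 2)).val ^ (p / 2) ≡ 1 [MOD p] := by
      rw [← ZMod.natCast_eq_natCast_iff]
      simpa using hsq
    have h2 := dvd_sub_pow_of_dvd_sub (R := ℤ) (Nat.modEq_iff_dvd.mp h1.symm) 1
    have h3 : (u : ZMod (p ^ 2)).val ^ (p / 2 * p) ≡ 1 [MOD p ^ 2] := by
      refine (Nat.modEq_iff_dvd.mpr ?_).symm
      simpa [pow_mul] using h2
    have h4 := Nat.le_of_dvd (Nat.mul_pos (by omega) hp.pos) (hdvd _ h3)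
    have h5 : p / 2 < p - 1 := by omega
    nlinarith
  · have h1 := hdvd _ h
    have h2 : p ^ 2 - 1 = (p + 1) * (p - 1) := by simpa using Nat.sq_sub_sq p 1
    rw [h2] at h1
    have h3 := Nat.dvd_of_mul_dvd_mul_right (by omega) h1
    exact hp.one_lt.ne' (Nat.dvd_one.mp ((Nat.dvd_add_right dvd_rfl).mp h3))

/-- `g ^ (p² - 1) - 1` is divisible by `p` but not by `p²`. For odd `p`, raising to the power `p ^
j` adds exactly `j` to the valuation. -/
theorem not_pow_mul_modEq_one (hp : p.Prime) (hp2 : p ≠ 2) {g : ℕ} (hg : g.Coprime p)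
    (h : ¬ g ^ (p ^ 2 - 1) ≡ 1 [MOD p ^ 2]) (j : ℕ) :
    ¬ g ^ ((p ^ 2 - 1) * p ^ j) ≡ 1 [MOD p ^ (j + 2)] := by
  intro hj
  have hfact := Fact.mk hp
  have h1 : (p : ℤ) ∣ (g ^ (p ^ 2 - 1) : ℤ) - 1 := by
    have h2 : (g : ZMod p) ≠ 0 := by
      rw [Ne, ZMod.natCast_eq_zero_iff]
      exact fun h => hp.one_lt.ne' (hg.symm.eq_one_of_dvd h)
    rw [← ZMod.intCast_zmod_eq_zero_iff_dvd]
    push_cast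
    rw [show p ^ 2 - 1 = (p - 1) * (p + 1) by rw [mul_comm]; simpa using Nat.sq_sub_sq p 1,
      pow_mul, ZMod.pow_card_sub_one_eq_one h2, one_pow, sub_self]
  have h2 : ¬ (p : ℤ) ∣ (g ^ (p ^ 2 - 1) : ℤ) := by
    intro h3
    exact hp.one_lt.ne' (Nat.dvd_one.mp (by exact_mod_cast (dvd_sub_right h3).mp h1))
  have h3 := Int.emultiplicity_pow_sub_pow hp (hp.odd_of_ne_two hp2) h1 h2 (p ^ j)
  rw [one_pow, emultiplicity_pow_self_of_prime (Nat.prime_iff.mp hp)] at h3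
  have h4 : emultiplicity (p : ℤ) ((g ^ (p ^ 2 - 1) : ℤ) - 1) < 2 := by
    refine emultiplicity_lt_iff_not_dvd.mpr fun h5 => h (Nat.modEq_iff_dvd.mpr ?_).symm
    exact_mod_cast h5
  have h5 : ((j + 2 : ℕ) : ℕ∞) ≤ emultiplicity (p : ℤ) (((g ^ (p ^ 2 - 1)) ^ p ^ j : ℤ) - 1) := by
    refine le_emultiplicity_of_pow_dvd ?_
    have := Nat.modEq_iff_dvd.mp hj.symm
    rw [pow_mul] at this
    exact_mod_cast this
  rw [h3] at h5
  have h6 : emultiplicity (p : ℤ) ((g ^ (p ^ 2 - 1) : ℤ) - 1) ≤ 1 := Order.le_of_lt_add_one h4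
  have h7 := h5.trans (add_le_add_left h6 (j : ℕ∞))
  norm_cast at h7
  omega

end PrimitiveRootModuloSquare

/-! ### Conjugates of roots of unity over `F` -/

section CyclotomicConjugates

open Polynomial

variable {F K : Type*} [Field F] [Field K] [Algebra F K] [IsAlgClosed K] [Algebra ℚ K]

/-- If `F` meets `ℚ(ω)` in `ℚ`, the minimal polynomial of the root of unity `ω` over `F` has rational
coefficients. -/
theorem IsPrimitiveRoot.minpoly_mem_lifts [Algebra ℚ F] [IsScalarTower ℚ F K] {n : ℕ} (hn : n ≠ 0)
    {ω : K} (hω : IsPrimitiveRoot ω n)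
    (hF : (IsScalarTower.toAlgHom ℚ F K).fieldRange ⊓ ℚ⟮ω⟯ = ⊥) :
    (minpoly F ω).map (algebraMap F K) ∈ lifts (algebraMap ℚ K) := by
  have hne := NeZero.mk hn
  have hint : IsIntegral F ω := (hω.isIntegral (Nat.pos_of_ne_zero hn)).tower_top
  -- All conjugates of `ω` are powers of `ω`, so the coefficients lie in `ℚ(ω)` as well as in `F`.
  have hroots : ∀ r ∈ ((minpoly F ω).map (algebraMap F K)).roots, r ∈ ℚ⟮ω⟯ := by
    intro r hr
    have h1 : minpoly F ω ∣ X ^ n - 1 := minpoly.dvd F ω (by simp [hω.pow_eq_one])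
    have h2 := Polynomial.map_dvd (algebraMap F K) h1
    have h3 := (isRoot_of_mem_roots hr).dvd h2
    have h4 : r ^ n = 1 := by
      simpa [sub_eq_zero] using h3
    obtain ⟨i, -, rfl⟩ := hω.eq_pow_of_pow_eq_one h4
    exact pow_mem (IntermediateField.mem_adjoin_simple_self ℚ ω) i
  have hcoeff : (minpoly F ω).map (algebraMap F K) ∈ lifts (algebraMap ℚ⟮ω⟯ K) := by
    rw [(IsAlgClosed.splits _).eq_prod_roots_of_monic ((minpoly.monic hint).map _)]
    refine multiset_prod_mem _ fun q hq => ?_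
    obtain ⟨r, hr, rfl⟩ := Multiset.mem_map.mp hq
    rw [lifts_iff_liftsRing]
    refine sub_mem ?_ ?_
    · rw [← lifts_iff_liftsRing]; exact X_mem_lifts _
    · rw [← lifts_iff_liftsRing]; exact C_mem_lifts _ (⟨r, hroots r hr⟩ : ℚ⟮ω⟯)
  rw [lifts_iff_coeff_lifts] at hcoeff ⊢
  intro i
  obtain ⟨z, hz⟩ := hcoeff i
  have hmem : ((minpoly F ω).map (algebraMap F K)).coeff i ∈
      (IsScalarTower.toAlgHom ℚ F K).fieldRange ⊓ ℚ⟮ω⟯ :=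
    ⟨⟨(minpoly F ω).coeff i, by simp⟩, hz ▸ z.2⟩
  rw [hF] at hmem
  exact IntermediateField.mem_bot.mp hmem

/-- Having rational coefficients, the minimal polynomial over `F` is a multiple of the cyclotomic
polynomial, so `ω ^ g` is one of its roots and a conjugate of `ω`. -/
theorem IsPrimitiveRoot.exists_algEquiv_apply_eq_pow [Algebra ℚ F] [IsScalarTower ℚ F K]
    [Algebra.IsAlgebraic F K] {n : ℕ} (hn : n ≠ 0) {ω : K} (hω : IsPrimitiveRoot ω n)
    (hF : (IsScalarTower.toAlgHom ℚ F K).fieldRange ⊓ ℚ⟮ω⟯ = ⊥) {g : ℕ} (hg : g.Coprime n) :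
    ∃ σ : K ≃ₐ[F] K, σ ω = ω ^ g := by
  have : CharZero K := algebraRat.charZero K
  have hn' := Nat.pos_of_ne_zero hn
  obtain ⟨f, hf⟩ := (lifts_iff_set_range _).mp (hω.minpoly_mem_lifts hn hF)
  have hcyc : minpoly ℚ ω ∣ f := by
    apply minpoly.dvd
    rw [← eval_map_algebraMap, hf, eval_map_algebraMap, minpoly.aeval]
  have hmin : ∀ {μ : K}, IsPrimitiveRoot μ n → minpoly ℚ μ = cyclotomic n ℚ := fun hμ => by
    convert (cyclotomic_eq_minpoly_rat hμ hn').symm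
    exact Subsingleton.elim _ _
  have hroot : aeval (ω ^ g) (minpoly F ω) = 0 := by
    rw [← eval_map_algebraMap, ← hf, eval_map_algebraMap]
    refine aeval_eq_zero_of_dvd_aeval_eq_zero hcyc ?_
    rw [hmin hω, ← hmin (hω.pow_of_coprime g hg), minpoly.aeval]
  have : Normal F K := ⟨fun x => IsAlgClosed.splits _⟩
  exact minpoly.exists_algEquiv_of_root' (Algebra.IsAlgebraic.isAlgebraic ω) hroot

end CyclotomicConjugates

/-! ### Division fields and the automorphism that separates them -/

section DivisionFields

open WeierstrassCurve WeierstrassCurve.Affine EllipticDivision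

variable {F K : Type*} [Field F] [Field K] [Algebra F K]

/-- The action of a field automorphism on the group of points of a base-changed curve. -/
noncomputable def pointAut [DecidableEq K] (E : WeierstrassCurve F) (σ : K ≃ₐ[F] K) :
    AddAut (E.baseChange K).toAffine.Point where
  toFun := Point.map (W' := E.toAffine) σ.toAlgHom
  invFun := Point.map (W' := E.toAffine) σ.symm.toAlgHom
  left_inv := by
    rintro (_ | ⟨x, y, h⟩)
    · rfl
    · change Point.some _ _ _ = Point.some _ _ _
      simp
  right_inv := by
    rintro (_ | ⟨x, y, h⟩)
    · rfl
    · change Point.some _ _ _ = Point.some _ _ _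
      simp
  map_add' := map_add _

theorem actsOnCoordinates_pointAut [DecidableEq K] (E : WeierstrassCurve F) (σ : K ≃ₐ[F] K) :
    ActsOnCoordinates (σ : K ≃+* K) (pointAut E σ) :=
  fun _ _ h => ⟨_, Point.map_some σ.toAlgHom h⟩

theorem apply_eq_of_mem_divisionField {E : WeierstrassCurve F} {n : ℕ} {σ : K ≃ₐ[F] K}
    (h : ∀ z ∈ torsionCoordinates F K E n, σ z = z) {z : K} (hz : z ∈ divisionField F K E n) :
    σ z = z := by
  have hle : divisionField F K E n ≤ IntermediateField.fixedField (Subgroup.zpowers σ) := by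
    refine IntermediateField.adjoin_le_iff.mpr fun z hz => ?_
    rintro ⟨τ, hτ⟩
    have hz' : σ ∈ MulAction.stabilizer (K ≃ₐ[F] K) z := h z hz
    exact Subgroup.zpowers_le.mpr hz' hτ
  exact hle hz ⟨σ, Subgroup.mem_zpowers σ⟩

open scoped Classical in
theorem apply_eq_of_mem_torsionCoordinates {E : WeierstrassCurve F} {n : ℕ} {σ : K ≃ₐ[F] K}
    {g : AddAut (E.baseChange K).toAffine.Point} (hg : ActsOnCoordinates (σ : K ≃+* K) g)
    (h : ∀ R : (E.baseChange K).toAffine.Point, n • R = 0 → g R = R) :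
    ∀ z ∈ torsionCoordinates F K E n, σ z = z := by
  rintro z ⟨x, y, hxy, hmem, hz⟩
  obtain ⟨h', h1⟩ := hg x y hxy
  rw [h _ hmem, Point.some.injEq] at h1
  rcases hz with rfl | rfl
  exacts [h1.1.symm, h1.2.symm]

open scoped Classical in
theorem apply_eq_of_torsionCoordinates {E : WeierstrassCurve F} {n : ℕ} {σ : K ≃ₐ[F] K}
    {g : AddAut (E.baseChange K).toAffine.Point} (hg : ActsOnCoordinates (σ : K ≃+* K) g)
    (h : ∀ z ∈ torsionCoordinates F K E n, σ z = z) (R : (E.baseChange K).toAffine.Point)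
    (hR : n • R = 0) : g R = R := by
  rcases R with _ | ⟨x, y, hxy⟩
  · exact map_zero g
  · obtain ⟨h', h1⟩ := hg x y hxy
    rw [h1, Point.some.injEq]
    exact ⟨h x ⟨x, y, hxy, hR, .inl rfl⟩, h y ⟨x, y, hxy, hR, .inr rfl⟩⟩

variable [IsAlgClosed K]

/-- The core of the argument, with `τ = σ ^ ((p² - 1) p ^ k)`. The index is shifted: level `k + 1`
of the torsion is compared with the `p ^ (k + 2)`-th roots of unity. -/
theorem exists_apply_eq_and_apply_ne [CharZero K] {E : WeierstrassCurve F} [E.IsElliptic] {p k : ℕ}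
    (hp : p.Prime) (hp2 : p ≠ 2) {η : K} (hη : IsPrimitiveRoot η (p ^ (k + 2)))
    (hσ : ∀ g : ℕ, g.Coprime (p ^ 2) → ∃ σ : K ≃ₐ[F] K, σ (η ^ p ^ k) = (η ^ p ^ k) ^ g) :
    ∃ τ : K ≃ₐ[F] K, (∀ z ∈ divisionField F K E (p ^ (k + 1)), τ z = z) ∧ τ η ≠ η := by
  classical
  have : (E.baseChange K).toAffine.IsElliptic := inferInstanceAs (E.map (algebraMap F K)).IsElliptic
  have hfact := Fact.mk hp
  have hne := NeZero.mk (pow_ne_zero (k + 2) hp.ne_zero)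
  have hne2 := NeZero.mk (pow_ne_zero 2 hp.ne_zero)
  obtain ⟨g, hgp, hsq, hmod⟩ := exists_not_isSquare_and_not_modEq hp hp2
  obtain ⟨σ, hσg⟩ := hσ g (hgp.pow_right 2)
  have hω : IsPrimitiveRoot (η ^ p ^ k) (p ^ 2) := hη.pow (pow_pos hp.pos _) (pow_add p k 2)
  -- The exponent `d` of `σ` on `η` is only known to agree with `g` mod `p²`. Both properties of `g`
  -- used below depend only on that residue.
  obtain ⟨d, -, hd⟩ := hη.eq_pow_of_pow_eq_one (ξ := σ η)
    (by rw [← map_pow, hη.pow_eq_one, map_one])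
  have hdg : d ≡ g [MOD p ^ 2] := by
    rw [map_pow, ← hd, ← pow_mul, mul_comm, pow_mul] at hσg
    have h1 := (isOfFinOrder_iff_pow_eq_one.mpr
      ⟨p ^ 2, pow_pos hp.pos 2, hω.pow_eq_one⟩).pow_eq_pow_iff_modEq.mp hσg
    rwa [← hω.eq_orderOf] at h1
  have hdg' : d ≡ g [MOD p] := hdg.of_dvd (dvd_pow_self p two_ne_zero)
  have hdp : d.Coprime p := by
    have := hdg'.gcd_eq
    rw [Nat.Coprime, this]
    exact hgp
  have hdsq : ¬ IsSquare (d : ZMod p) := by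
    rwa [(ZMod.natCast_eq_natCast_iff d g p).mpr hdg']
  have hdmod := not_pow_mul_modEq_one hp hp2 hdp (fun h => hmod ((hdg.pow _).symm.trans h)) k
  have hact := actsOnCoordinates_pointAut E σ
  have hroots : ∀ ξ : K, ξ ^ p = 1 → (σ : K ≃+* K) ξ = ξ ^ d := by
    intro ξ hξ
    obtain ⟨i, -, rfl⟩ := hη.eq_pow_of_pow_eq_one (ξ := ξ)
      (by rw [pow_succ', pow_mul, hξ, one_pow])
    rw [map_pow, AlgEquiv.coe_ringEquiv, ← hd, ← pow_mul, mul_comm, pow_mul]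
  have h1 : ∀ R : (E.baseChange K).toAffine.Point, p • R = 0 →
      ((p ^ 2 - 1) • pointAut E σ) R = R := fun R hR => hact.nsmul_apply_eq hp hp2 hroots hdsq hR
  have h2 := AddAut.pow_nsmul_apply_eq h1 k
  have hpow : ∀ m : ℕ, ((σ ^ m : K ≃ₐ[F] K) : K ≃+* K) = (σ : K ≃+* K) ^ m := by
    intro m
    induction m with
    | zero => rfl
    | succ m ih => rw [pow_succ, pow_succ, ← ih]; rfl
  rw [← mul_nsmul] at h2
  refine ⟨σ ^ ((p ^ 2 - 1) * p ^ k), ?_, ?_⟩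
  · refine fun z => apply_eq_of_mem_divisionField (apply_eq_of_mem_torsionCoordinates
      (g := ((p ^ 2 - 1) * p ^ k) • pointAut E σ) ?_ h2)
    rw [hpow]
    exact hact.nsmul _
  · have h3 : ∀ m : ℕ, (σ ^ m) η = η ^ d ^ m := by
      intro m
      induction m with
      | zero => simp
      | succ m ih =>
        rw [pow_succ, AlgEquiv.mul_apply, ← hd, map_pow, ih, ← pow_mul, pow_succ]
    rw [h3]
    intro h4
    apply hdmod
    have h5 := (isOfFinOrder_iff_pow_eq_one.mpr ⟨p ^ (k + 2), pow_pos hp.pos _,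
      hη.pow_eq_one⟩).pow_eq_pow_iff_modEq.mp (h4.trans (pow_one η).symm)
    rwa [← hη.eq_orderOf] at h5

theorem apply_eq_of_forall_mem_divisionField [CharZero K] {E : WeierstrassCurve F} [E.IsElliptic]
    {p m : ℕ} (hp : p.Prime) (hp2 : p ≠ 2) {ξ : K} (hξ : ξ ^ p ^ (m + 1) = 1) {σ : K ≃ₐ[F] K}
    (hσ : ∀ z ∈ divisionField F K E (p ^ (m + 1)), σ z = z) : σ ξ = ξ := by
  classical
  have : (E.baseChange K).toAffine.IsElliptic := inferInstanceAs (E.map (algebraMap F K)).IsElliptic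
  have hact := actsOnCoordinates_pointAut E σ
  exact hact.apply_eq_of_pow_eq_one hp hp2 (apply_eq_of_torsionCoordinates hact fun z hz =>
    hσ z (IntermediateField.subset_adjoin F _ hz)) hξ

end DivisionFields

theorem mainTheorem5 (F : Type*) [Field F] [NumberField F]
    (E : WeierstrassCurve F) [E.IsElliptic]
    (ζ : ℕ → AlgebraicClosure F) (hζ : ∀ m : ℕ, 1 ≤ m → IsPrimitiveRoot (ζ m) m)
    (p : ℕ) (hp : p.Prime) (k : ℕ) (hk : 1 ≤ k)
    (hF : (IsScalarTower.toAlgHom ℚ F (AlgebraicClosure F)).fieldRange ⊓ ℚ⟮ζ (p ^ k)⟯ = ⊥)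
    (hF_one : k = 1 →
      (IsScalarTower.toAlgHom ℚ F (AlgebraicClosure F)).fieldRange ⊓ ℚ⟮ζ (p ^ 2)⟯ = ⊥) :
    (F⟮ζ (p ^ (k + 1))⟯ ≤ EllipticDivision.divisionField F (AlgebraicClosure F) E (p ^ k) →
      p = 2) ∧
    (EllipticDivision.divisionField F (AlgebraicClosure F) E (p ^ k) =
        EllipticDivision.divisionField F (AlgebraicClosure F) E (p ^ (k + 1)) →
      p = 2) := by
  by_cases hp2 : p = 2
  · exact ⟨fun _ => hp2, fun _ => hp2⟩
  have hprim : ∀ j : ℕ, IsPrimitiveRoot (ζ (p ^ j)) (p ^ j) :=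
    fun j => hζ _ (Nat.one_le_pow _ _ hp.pos)
  have : CharZero (AlgebraicClosure F) :=
    charZero_of_injective_algebraMap (algebraMap F (AlgebraicClosure F)).injective
  obtain ⟨k, rfl⟩ := Nat.exists_eq_add_of_le' hk
  have hη := hprim (k + 2)
  -- The roots `ζ m` need not be compatible, so the `p²`-th root is taken as a power of `ζ (p ^ (k +
  -- 2))` rather than `ζ (p ^ 2)`.
  have hω : IsPrimitiveRoot (ζ (p ^ (k + 2)) ^ p ^ k) (p ^ 2) :=
    hη.pow (pow_pos hp.pos _) (pow_add p k 2)
  have hmem : ∀ j, 2 ≤ j → ζ (p ^ (k + 2)) ^ p ^ k ∈ ℚ⟮ζ (p ^ j)⟯ := by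
    intro j hj
    have hne := NeZero.mk (pow_ne_zero j hp.ne_zero)
    obtain ⟨i, -, hi⟩ := (hprim j).eq_pow_of_pow_eq_one (ξ := ζ (p ^ (k + 2)) ^ p ^ k) (by
      obtain ⟨i, rfl⟩ := Nat.exists_eq_add_of_le hj
      rw [pow_add p 2 i, pow_mul, hω.pow_eq_one, one_pow])
    rw [← hi]
    exact pow_mem (IntermediateField.mem_adjoin_simple_self ℚ _) i
  have hF2 : (IsScalarTower.toAlgHom ℚ F (AlgebraicClosure F)).fieldRange ⊓
      ℚ⟮ζ (p ^ (k + 2)) ^ p ^ k⟯ = ⊥ := by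
    obtain ⟨j, hj, hFj⟩ : ∃ j, 2 ≤ j ∧
        (IsScalarTower.toAlgHom ℚ F (AlgebraicClosure F)).fieldRange ⊓ ℚ⟮ζ (p ^ j)⟯ = ⊥ := by
      -- The original exponent is now `k + 1`. If it is at least 2, disjointness from the `p²`-th
      -- roots follows from `hF`; if it is 1, this is the extra hypothesis.
      rcases Nat.eq_zero_or_pos k with rfl | hk0
      · exact ⟨2, le_rfl, hF_one rfl⟩
      · exact ⟨k + 1, by omega, hF⟩
    rw [eq_bot_iff, ← hFj]
    exact inf_le_inf_left _ (IntermediateField.adjoin_simple_le_iff.mpr (hmem j hj))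
  obtain ⟨τ, hτ, hτη⟩ := exists_apply_eq_and_apply_ne (E := E) hp hp2 hη fun g hg =>
    hω.exists_algEquiv_apply_eq_pow (pow_ne_zero 2 hp.ne_zero) hF2 hg
  refine ⟨fun h => absurd ?_ hτη, fun h => absurd ?_ hτη⟩
  · exact hτ _ (h (IntermediateField.mem_adjoin_simple_self F _))
  · exact apply_eq_of_forall_mem_divisionField (m := k + 1) hp hp2 hη.pow_eq_one
      fun z hz => hτ z (h.ge hz)
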